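/- Let $d\ge 1$ and consider the infinite chain with sites $\mathbb Z$ and local Hilbert space $\mathbb C^d$. Let $\mathcal B$ be the space of operators on $\mathbb C^d$ and $\mathcal B_0\subset\mathcal B$ the traceless ones. A formal operator is a family $\Phi=(\Phi(A))_A$, written $\Phi=\sum_A\Phi(A)$, indexed by the finite sets $A\subset\mathbb Z$, with $\Phi(A)\in\mathcal B_0^{\otimes A}$ (and $\Phi(\emptyset)\in\mathbb C$). For formal operators $\Phi,\Psi$, where $\Phi$ has finite range (i.e. $\max A-\min A$ is bounded over the nonempty sets $A$ with $\Phi(A)\ne0$), the commutator is defined by $[\Phi,\Psi](A)=\big[\sum_{C\subset B}\Phi(C),\sum_{C'\subset B}\Psi(C')\big]_A$ for any sufficiently large finite $B\supset A$, where $Y_A$ is the component of $Y$ in $\mathcal B_0^{\otimes A}$ under $\mathcal B^{\otimes B}=\bigoplus_{A\subset B}\mathcal B_0^{\otimes A}$. Let $H=\sum_{i\in\mathbb Z}h^{(2)}_i+\sum_{i\in\mathbb Z}h^{(1)}_i$ be a Hermitian, translation invariant Hamiltonian with $h^{(2)}_i\in\mathcal B_0\otimes\mathcal B_0$ acting on the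 sites $i,i+1$ and $h^{(1)}_i\in\mathcal B_0$ acting on the site $i$. Let $C$ be an arbitrary translation invariant, at most one-local operator (a sum of one-site operators $c_i$, possibly zero, possibly plus a constant), and define the boost operator $B_H=\sum_{j\in\mathbb Z}j\,(h^{(2)}_j+h^{(1)}_j)+C$. Set $Q^{(2)}=H$ and $Q^{(n+1)}=[B_H,Q^{(n)}]$ for $n\ge2$. For a translation invariant formal operator $\Phi$, its finite-size version on the periodic chain of length $N$ is $\Phi_{[N]}=\Phi(\emptyset)+\sum_{x=0}^{N-1}\tau_{[N]}(x)\Big[\sum_{1\in A\subset\{1,\dots,N\}}\Phi(A)\Big]\tau_{[N]}(x)^\dagger$, where $\tau_{[N]}(x)$ is the cyclic translation by $x$ sites. Suppose that $[H_{[N_0]},Q^{(3)}_{[N_0]}]=0$ for some $N_0\ge6$. Then every $Q^{(n)}$, $n\ge2$, is translation invariant (so that its finite-size versions are defined), and $[Q^{(n)}_{[N]},Q^{(m)}_{[N]}]=0$ for all $N\ge4$ and all integers $n,m$ with $2\le n,m\le N/2$. In particular, $Q^{(n)}_{[N]}$ is a conserved quantity of $H_{[N]}$, i.e. $[H_{[N]},Q^{(n)}_{[N]}]=0$,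 for all $N\ge4$ and all $2\le n\le N/2$. -/

import Mathlib

namespace SpinChain

/-- Linear operators on the Hilbert space `(ℂ^d)^{⊗ S}` of a set `S` of sites, written as matrices
in the product basis, which is indexed by the configurations `S → Fin d`. -/
abbrev Op (d : ℕ) (S : Type) : Type := Matrix (S → Fin d) (S → Fin d) ℂ

open Classical in
/-- For an injective map of sites `f : S → T`, the operator on `T` that acts as `X` on the sites
`f(S)` (with `s` renamed to `f s`) and as the identity on all other sites. -/
noncomputable def transport {d : ℕ} {S T : Type} (f : S → T) (X : Op d S) : Op d T :=
  fun σ τ => if ∀ t, t ∉ Set.range f → σ t = τ t then X (σ ∘ f) (τ ∘ f) else 0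

/-- All partial traces of `X` over a single site vanish. On a finite set of sites this says that
`X` belongs to the tensor power, over the sites, of the space of traceless operators. -/
def SiteTraceless {d : ℕ} {S : Type} [DecidableEq S] (X : Op d S) : Prop :=
  ∀ (i : S) (σ τ : S → Fin d), ∑ a, X (Function.update σ i a) (Function.update τ i a) = 0

/-- Matrix elements of the map `Y ↦ Y - (tr Y / d) 1` on operators on `ℂ^d`. -/
noncomputable def tracelessKernel (d : ℕ) (s t s' t' : Fin d) : ℂ :=
  (if s' = s ∧ t' = t then 1 else 0) - (if s = t ∧ s' = t' then (d : ℂ)⁻¹ else 0)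

/-- Matrix elements of the functional `Y ↦ tr Y / d` on operators on `ℂ^d`. -/
noncomputable def traceKernel (d : ℕ) (s' t' : Fin d) : ℂ :=
  if s' = t' then (d : ℂ)⁻¹ else 0

/-- For `A ⊆ B` and an operator `Y` on `B`, the component `Y_A` of `Y` in the decomposition of the
operators on `B` as the direct sum, over the subsets `A` of `B`, of the operators that are traceless
at each site of `A` and the identity at each site of `B \ A`. It is obtained by applying
`Y ↦ Y - (tr Y / d) 1` at the sites of `A` and `Y ↦ tr Y / d` at the sites of `B \ A`. -/
noncomputable def component {d : ℕ} (A : Finset ℤ) {B : Finset ℤ} (Y : Op d B) : Op d A :=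
  fun σ τ => ∑ σ' : B → Fin d, ∑ τ' : B → Fin d,
    (∏ i : B, if h : (i : ℤ) ∈ A then tracelessKernel d (σ ⟨i, h⟩) (τ ⟨i, h⟩) (σ' i) (τ' i)
      else traceKernel d (σ' i) (τ' i)) * Y σ' τ'

lemma sum_tracelessKernel {d : ℕ} (s' t' : Fin d) : ∑ a, tracelessKernel d a a s' t' = 0 := by
  have hd : (d : ℂ) ≠ 0 := by
    have := s'.pos
    exact_mod_cast this.ne'
  by_cases h : s' = t'
  · subst h
    simp [tracelessKernel, hd]
  · have : ∀ a : Fin d, ¬ (s' = a ∧ t' = a) := fun a ha => h (ha.1.trans ha.2.symm)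
    simp [tracelessKernel, h, this]

lemma siteTraceless_component {d : ℕ} {A B : Finset ℤ} (hAB : A ⊆ B) (Y : Op d B) :
    SiteTraceless (component A Y) := by
  intro i σ τ
  simp only [component]
  rw [Finset.sum_comm]
  refine Finset.sum_eq_zero fun σ' _ => ?_
  rw [Finset.sum_comm]
  refine Finset.sum_eq_zero fun τ' _ => ?_
  rw [← Finset.sum_mul]
  refine mul_eq_zero_of_left ?_ _
  have hi : (⟨i, hAB i.2⟩ : B) ∈ (Finset.univ : Finset B) := Finset.mem_univ _
  simp only [← Finset.mul_prod_erase _ _ hi]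
  have hrest : ∀ a : Fin d, ∀ j ∈ Finset.univ.erase (⟨i, hAB i.2⟩ : B),
      (if h : (j : ℤ) ∈ A then tracelessKernel d (Function.update σ i a ⟨j, h⟩)
        (Function.update τ i a ⟨j, h⟩) (σ' j) (τ' j) else traceKernel d (σ' j) (τ' j)) =
      (if h : (j : ℤ) ∈ A then tracelessKernel d (σ ⟨j, h⟩) (τ ⟨j, h⟩) (σ' j) (τ' j)
        else traceKernel d (σ' j) (τ' j)) := by
    intro a j hj
    have hne : ∀ h : (j : ℤ) ∈ A, (⟨j, h⟩ : A) ≠ i := by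
      intro h he
      exact (Finset.mem_erase.1 hj).1 (Subtype.ext (congrArg (fun k : A => (k : ℤ)) he))
    by_cases h : (j : ℤ) ∈ A
    · simp [h, Function.update_of_ne (hne h)]
    · simp [h]
  simp only [Finset.prod_congr rfl (hrest _)]
  rw [← Finset.sum_mul]
  refine mul_eq_zero_of_left ?_ _
  simp [sum_tracelessKernel]

/-- A formal operator `Φ = ∑_A Φ(A)` on the infinite chain `ℤ` with local dimension `d`: a family
indexed by the finite sets `A` of sites, where `Φ(A)` is an operator on `A` that is traceless at
every site of `A`. -/
@[ext]
structure FormalOp (d : ℕ) where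
  /-- The term of the formal sum that is supported on `A`. -/
  term : (A : Finset ℤ) → Op d A
  siteTraceless : ∀ A, SiteTraceless (term A)

/-- The range `max A - min A + 1` of a finite set of sites, with value `0` for the empty set. -/
noncomputable def setRange (A : Finset ℤ) : ℕ :=
  if h : A.Nonempty then (A.max' h - A.min' h + 1).toNat else 0

/-- The translate `A + x`. -/
def shift (A : Finset ℤ) (x : ℤ) : Finset ℤ := A.image (· + x)

/-- The translation of sites `a ↦ a + x` as a map from `A` to `A + x`. -/
def shiftMap (A : Finset ℤ) (x : ℤ) (a : A) : shift A x :=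
  ⟨(a : ℤ) + x, Finset.mem_image_of_mem (· + x) a.2⟩

namespace FormalOp

variable {d : ℕ}

/-- The supremum of the ranges of the sets `A` with `Φ(A) ≠ 0`; only meaningful if these ranges are
bounded. -/
noncomputable def range (Φ : FormalOp d) : ℕ :=
  sSup {r | ∃ A, Φ.term A ≠ 0 ∧ setRange A = r}

/-- Self-adjointness. -/
def IsSelfAdjoint (Φ : FormalOp d) : Prop := ∀ A, (Φ.term A).IsHermitian

/-- Translation invariance: `Φ(A + x)` is the translate of `Φ(A)` for all `A` and `x`. -/
def IsTranslationInvariant (Φ : FormalOp d) : Prop :=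
  ∀ (A : Finset ℤ) (x : ℤ), Φ.term (shift A x) = transport (shiftMap A x) (Φ.term A)

/-- `Φ` consists of nearest-neighbour interactions and on-site potentials only. -/
def IsNearestNeighbor (Φ : FormalOp d) : Prop :=
  ∀ A, Φ.term A ≠ 0 → ∃ i : ℤ, A = {i} ∨ A = {i, i + 1}

/-- `Φ` is at most one-local: a sum of one-site operators (and possibly a constant). -/
def IsOneLocal (Φ : FormalOp d) : Prop := ∀ A, Φ.term A ≠ 0 → setRange A ≤ 1

/-- The restriction `∑_{A ⊆ B} Φ(A)` of `Φ` to a finite set `B` of sites, an operator on `B`. -/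
noncomputable def restrict (Φ : FormalOp d) (B : Finset ℤ) : Op d B :=
  ∑ A ∈ B.powerset.attach,
    transport (fun a : A.1 => (⟨a, Finset.mem_powerset.1 A.2 a.2⟩ : B)) (Φ.term A.1)

end FormalOp

/-- The set of all sites at distance at most `r` from `A`. -/
noncomputable def thicken (A : Finset ℤ) (r : ℕ) : Finset ℤ :=
  A.biUnion fun a => Finset.Icc (a - r) (a + r)

lemma subset_thicken (A : Finset ℤ) (r : ℕ) : A ⊆ thicken A r := by
  intro a ha
  simp only [thicken, Finset.mem_biUnion, Finset.mem_Icc]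
  exact ⟨a, ha, by omega, by omega⟩

namespace FormalOp

variable {d : ℕ}

/-- The commutator `[Φ, Ψ]` of formal operators, for `Φ` of finite range: `[Φ, Ψ](A)` is the
component on `A` of the commutator of the restrictions of `Φ` and `Ψ` to a large finite set `B ⊇ A`.
The component on `A` of `[Φ(C), Ψ(C')]` vanishes unless `C` meets `A` and `C' ⊆ A ∪ C`, so every `B`
that contains all sites at distance at most `r(Φ)` from `A` gives the same value; the smallest such
`B` is used. -/
noncomputable def comm (Φ Ψ : FormalOp d) : FormalOp d where
  term A := component A ⁅Φ.restrict (thicken A Φ.range), Ψ.restrict (thicken A Φ.range)⁆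
  siteTraceless A := siteTraceless_component (subset_thicken A Φ.range) _

open Classical in
/-- The boost operator `∑_j j (h²_j + h¹_j) + C` of a nearest-neighbour Hamiltonian
`H = ∑_j (h²_j + h¹_j)`, where `h²_j` acts on the sites `j, j + 1` and `h¹_j` on the site `j`: the
term of `H` supported on `A` is multiplied by the left-most site of `A`. -/
noncomputable def boost (H C : FormalOp d) : FormalOp d where
  term A := (if h : A.Nonempty then ((A.min' h : ℤ) : ℂ) else 0) • H.term A + C.term A
  siteTraceless A i σ τ := by
    have h1 := H.siteTraceless A i σ τ
    have h2 := C.siteTraceless A i σ τ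
    simp only [Matrix.add_apply, Matrix.smul_apply, smul_eq_mul, Finset.sum_add_distrib,
      ← Finset.mul_sum, h1, h2, mul_zero, add_zero]

/-- The charges `Q^(n)`, `n ≥ 2`: `Q^(2) = H` and `Q^(n+1) = [B, Q^(n)]` with the boost operator
`B` of `H`. -/
noncomputable def charge (H C : FormalOp d) (n : ℕ) : FormalOp d :=
  (fun Q => (boost H C).comm Q)^[n - 2] H

/-- The finite-size version `Φ_[N]` of a translation invariant formal operator `Φ` on the periodic
chain with `N` sites: the constant term of `Φ`, plus the sum of the `N` cyclic translates of
`∑ Φ(A)`, where `A` runs over the subsets of `{1, …, N}` that contain `1`. -/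
noncomputable def finiteSize (N : ℕ) [NeZero N] (Φ : FormalOp d) : Op d (ZMod N) :=
  transport (fun a : (∅ : Finset ℤ) => ((a : ℤ) : ZMod N)) (Φ.term ∅) +
    ∑ x : ZMod N, ∑ A ∈ (Finset.Icc (1 : ℤ) N).powerset with (1 : ℤ) ∈ A,
      transport (fun a : A => ((a : ℤ) : ZMod N) + x) (Φ.term A)

end FormalOp

end SpinChain

set_option linter.unusedSectionVars false

/-! In the clock-and-shift basis a formal operator becomes a coefficient function on finitely
supported strings of labels, and the commutator becomes a convolution twisted by a bicharacter,
`brk`. The same bicharacter governs products on a periodic chain, so identities can be moved between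
the infinite chain and rings. By `lie_ringOp`, passing to finite size respects commutators of
translation invariant operators of ranges r and s once N ≥ r + s - 1. By
`eq_zero_of_ringOp_eq_zero`, a translation invariant operator of range r without constant term is
determined by its version on a ring with N ≥ 2r - 1.

Write B for the boost. Counting ranges only bounds the range of [H, Q^(3)] by four, but the Jacobi
identity removes the range-four part for every nearest-neighbour H (`brk_brk_boost`). The range is
therefore at most three, and vanishing on one ring with N₀ ≥ 6 already gives [H, Q^(3)] = 0 on the
infinite chain.

Induction on n then yields [H, Q^(n)] = 0 (`charges_of_brk_eq_zero`). Translating B by x changes it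
by a multiple x of H, so [B, Q^(n)] is translation invariant when Q^(n) is and commutes with H.
Jacobi gives [H, Q^(n+1)] = -[Q^(3), Q^(n)], which commutes with H; hence ad_H² kills Q^(n+1). On a
long ring ad_H is self-adjoint for the Hilbert–Schmidt product, so ad_H itself kills it
(`brk_eq_zero_of_brk_brk`).

Mutual commutation (`charges_commute`) follows from [Q^(n+1), Q^(m)] = [B, [Q^(n), Q^(m)]] - [Q^(n),
Q^(m+1)]. Since Q^(n) has range at most n, the condition n, m ≤ N/2 lets `lie_ringOp` carry this to
the ring. -/

namespace SpinChain

/-! ### The clock-and-shift basis on one site -/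

section OneSite

variable {d : ℕ}

/-- Labels of the clock-and-shift basis of the operators on one site. -/
abbrev Label (d : ℕ) : Type := Fin d × Fin d

/-- The bicharacter `(b, t) ↦ exp (2πi b t / d)` of `ℤ/d`. -/
noncomputable def rootChar (b t : Fin d) : ℂ :=
  Complex.exp (2 * Real.pi * Complex.I / d) ^ (b.val * t.val)

lemma rootChar_comm (b t : Fin d) : rootChar b t = rootChar t b := by
  simp [rootChar, mul_comm]

variable [NeZero d]

lemma isPrimitiveRoot_exp_div (d : ℕ) [NeZero d] :
    IsPrimitiveRoot (Complex.exp (2 * Real.pi * Complex.I / d)) d :=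
  Complex.isPrimitiveRoot_exp d (NeZero.ne d)

lemma rootChar_add_left (b c t : Fin d) : rootChar (b + c) t = rootChar b t * rootChar c t := by
  have h := (isPrimitiveRoot_exp_div d).pow_eq_one
  rw [rootChar, rootChar, rootChar, ← pow_add, ← add_mul, Fin.val_add, pow_mul, pow_mul,
    pow_eq_pow_mod (b.val + c.val) h]

lemma rootChar_add_right (b c t : Fin d) : rootChar t (b + c) = rootChar t b * rootChar t c := by
  rw [rootChar_comm, rootChar_add_left, rootChar_comm b, rootChar_comm c]

@[simp] lemma rootChar_zero_left (t : Fin d) : rootChar 0 t = 1 := by simp [rootChar]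

@[simp] lemma rootChar_zero_right (t : Fin d) : rootChar t 0 = 1 := by simp [rootChar]

lemma sum_rootChar (b : Fin d) : ∑ t, rootChar b t = if b = 0 then (d : ℂ) else 0 := by
  split_ifs with hb
  · subst hb; simp
  · have hζ := isPrimitiveRoot_exp_div d
    set ζ := Complex.exp (2 * Real.pi * Complex.I / d) with hdef
    have h1 : ζ ^ b.val ≠ 1 := by
      intro h
      have := Nat.le_of_dvd (Nat.pos_of_ne_zero fun h0 => hb (Fin.ext h0)) (hζ.dvd_of_pow_eq_one _ h)
      omega
    have h2 : ∑ t : Fin d, rootChar b t = ∑ i ∈ Finset.range d, (ζ ^ b.val) ^ i := by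
      rw [Finset.sum_range]
      exact Finset.sum_congr rfl fun t _ => by rw [rootChar, pow_mul]
    rw [h2]
    have h3 := mul_neg_geom_sum (ζ ^ b.val) d
    rw [← pow_mul, mul_comm b.val d, pow_mul, hζ.pow_eq_one, one_pow, sub_self] at h3
    exact (mul_eq_zero.1 h3).resolve_left (sub_ne_zero.2 (Ne.symm h1))

/-- The clock-and-shift basis of the operators on one site. -/
noncomputable def site (α : Label d) (s t : Fin d) : ℂ :=
  if s = t + α.1 then rootChar α.2 t else 0

/-- The basis dual to `site`. -/
noncomputable def dualSite (α : Label d) (s t : Fin d) : ℂ :=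
  if s = t + α.1 then rootChar (-α.2) t / d else 0

lemma site_zero (s t : Fin d) : site (0 : Label d) s t = if s = t then 1 else 0 := by
  simp [site]

lemma dualSite_zero (s t : Fin d) : dualSite (0 : Label d) s t = if s = t then (d : ℂ)⁻¹ else 0 := by
  simp [dualSite]

/-- The basis is a projective representation of (ℤ/d)²: a product of two basis operators is a single
basis operator up to a phase. This turns every later commutator into bookkeeping of phases. -/
lemma sum_site_mul_site (α β : Label d) (s t : Fin d) :
    ∑ u, site α s u * site β u t = rootChar α.2 β.1 * site (α + β) s t := by
  have h : ∀ u, site α s u * site β u t =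
      if u = t + β.1 then (if s = t + (α + β).1 then rootChar α.2 β.1 * rootChar (α + β).2 t else 0)
        else 0 := by
    intro u
    simp only [site]
    by_cases hu : u = t + β.1
    · subst hu
      have : t + β.1 + α.1 = t + (α + β).1 := by rw [Prod.fst_add]; abel
      simp only [this, if_true]
      split_ifs
      · rw [rootChar_add_right, Prod.snd_add, rootChar_add_left]; ring
      · simp
    · simp [hu]
  rw [Finset.sum_congr rfl fun u _ => h u, Finset.sum_ite_eq', if_pos (Finset.mem_univ _)]
  simp only [site, mul_ite, mul_zero]

lemma sum_dualSite_mul_site (α β : Label d) :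
    ∑ s, ∑ t, dualSite α s t * site β s t = if α = β then 1 else 0 := by
  have hd : (d : ℂ) ≠ 0 := by exact_mod_cast NeZero.ne d
  have h : ∀ t, ∑ s, dualSite α s t * site β s t =
      if α.1 = β.1 then rootChar (-α.2 + β.2) t / d else 0 := by
    intro t
    simp only [dualSite, site, ite_mul, zero_mul, Finset.sum_ite_eq', Finset.mem_univ, if_true,
      add_right_inj, mul_ite, mul_zero, rootChar_add_left, eq_comm (a := β.1)]
    split_ifs <;> ring
  rw [Finset.sum_comm]
  simp only [h]
  by_cases h1 : α.1 = β.1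
  · simp only [h1, if_true, ← Finset.sum_div, sum_rootChar]
    by_cases h2 : α.2 = β.2
    · simp [Prod.ext_iff, h1, h2, hd]
    · have : -α.2 + β.2 ≠ 0 := by
        intro h; exact h2 (neg_add_eq_zero.1 h)
      simp [Prod.ext_iff, h2, this]
  · simp [Prod.ext_iff, h1]

lemma sum_site_mul_dualSite (s t s' t' : Fin d) :
    ∑ α : Label d, site α s t * dualSite α s' t' = if s = s' ∧ t = t' then 1 else 0 := by
  have hd : (d : ℂ) ≠ 0 := by exact_mod_cast NeZero.ne d
  rw [Fintype.sum_prod_type]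
  have h : ∀ a b : Fin d, site (a, b) s t * dualSite (a, b) s' t' =
      if a = s - t then (if s' = t' + (s - t) then rootChar (t - t') b / d else 0) else 0 := by
    intro a b
    simp only [site, dualSite]
    have e1 : (s = t + a) ↔ (a = s - t) := by
      constructor
      · rintro rfl; abel
      · rintro rfl; abel
    by_cases ha : a = s - t
    · subst ha
      have e2 : rootChar (-b) t' = rootChar (-t') b := by
        have i1 : rootChar (-b) t' * rootChar b t' = 1 := by rw [← rootChar_add_left]; simp
        have i2 : rootChar (-t') b * rootChar b t' = 1 := by
          rw [rootChar_comm b, ← rootChar_add_left]; simp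
        exact mul_right_cancel₀ (right_ne_zero_of_mul_eq_one i1) (i1.trans i2.symm)
      simp only [e1, if_true, e2, sub_eq_add_neg t, rootChar_add_left, rootChar_comm b t]
      split_ifs <;> ring
    · simp [e1, ha]
  simp only [h]
  rw [Finset.sum_comm]
  simp only [Finset.sum_ite_eq', Finset.mem_univ, if_true]
  by_cases h1 : s' = t' + (s - t)
  · simp only [h1, if_true, ← Finset.sum_div, sum_rootChar]
    by_cases h2 : t = t'
    · subst h2; simp [hd]
    · simp [h2, sub_eq_zero]
  · have : ¬ (s = s' ∧ t = t') := by
      rintro ⟨rfl, rfl⟩; apply h1; abel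
    simp [h1, this]

lemma sum_site_diag (α : Label d) : ∑ s, site α s s = if α = 0 then (d : ℂ) else 0 := by
  have h : ∀ s, site α s s = if α.1 = 0 then rootChar α.2 s else 0 := by
    intro s
    simp [site]
  simp only [h]
  by_cases h1 : α.1 = 0
  · simp [h1, sum_rootChar, Prod.ext_iff]
  · simp [h1, Prod.ext_iff]

lemma sum_traceKernel_mul_site (α : Label d) :
    ∑ s, ∑ t, traceKernel d s t * site α s t = if α = 0 then 1 else 0 := by
  have hd : (d : ℂ) ≠ 0 := by exact_mod_cast NeZero.ne d
  simp only [traceKernel, ite_mul, zero_mul, Finset.sum_ite_eq, Finset.mem_univ, if_true,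
    ← Finset.mul_sum, sum_site_diag]
  split_ifs <;> simp [hd]

/-- Label 0 is the identity and every other label is traceless, so the kernels defining `component`
act diagonally on the basis. -/
lemma sum_tracelessKernel_mul_site (α : Label d) (s t : Fin d) :
    ∑ s', ∑ t', tracelessKernel d s t s' t' * site α s' t' =
      if α = 0 then 0 else site α s t := by
  have hd : (d : ℂ) ≠ 0 := by exact_mod_cast NeZero.ne d
  have h1 : ∀ s' t', tracelessKernel d s t s' t' * site α s' t' =
      (if s' = s then (if t' = t then site α s' t' else 0) else 0) -
        (if s = t then traceKernel d s' t' * site α s' t' else 0) := by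
    intro s' t'
    simp only [tracelessKernel, traceKernel]
    split_ifs <;> simp_all [sub_mul]
  simp only [h1, Finset.sum_sub_distrib]
  by_cases hst : s = t
  · simp only [hst, if_true, sum_traceKernel_mul_site]
    split_ifs with h0 <;> simp [h0, site_zero]
  · simp only [hst, if_false]
    split_ifs with h0 <;> simp [h0, site_zero, hst]

end OneSite

/-! ### The product basis and coefficients of operators on finitely many sites -/

/-- Sums over two configurations factorize over the sites. -/
lemma prod_sum_sum {d : ℕ} {T : Type} [Fintype T] [DecidableEq T] (F : T → Fin d → Fin d → ℂ) :
    ∑ σ : T → Fin d, ∑ τ : T → Fin d, ∏ t, F t (σ t) (τ t) = ∏ t, ∑ a, ∑ b, F t a b := by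
  rw [Fintype.prod_sum]
  exact Finset.sum_congr rfl fun σ _ => (Fintype.prod_sum fun t b => F t (σ t) b).symm

section Symbol

variable {d : ℕ} {S T : Type} [Fintype S] [DecidableEq S] [Fintype T] [DecidableEq T]

/-- Products over the sites of the one-site basis operators. -/
noncomputable def mon [NeZero d] (g : T → Label d) : Op d T :=
  fun σ τ => ∏ t, site (g t) (σ t) (τ t)

/-- The coefficient of `mon g` in an operator. -/
noncomputable def symbol [NeZero d] (g : T → Label d) : Op d T →ₗ[ℂ] ℂ where
  toFun X := ∑ σ, ∑ τ, (∏ t, dualSite (g t) (σ t) (τ t)) * X σ τ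
  map_add' X Y := by simp [mul_add, Finset.sum_add_distrib]
  map_smul' c X := by
    simp only [Matrix.smul_apply, smul_eq_mul, RingHom.id_apply, Finset.mul_sum]
    exact Finset.sum_congr rfl fun _ _ => Finset.sum_congr rfl fun _ _ => by ring

lemma symbol_apply [NeZero d] (g : T → Label d) (X : Op d T) :
    symbol g X = ∑ σ, ∑ τ, (∏ t, dualSite (g t) (σ t) (τ t)) * X σ τ := rfl

/-- The bicharacter of labels with `mon g * mon h = phase g h • mon (g + h)`. -/
noncomputable def phase (g h : T → Label d) : ℂ := ∏ t, rootChar (g t).2 (h t).1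

variable [NeZero d]

lemma mon_zero : mon (0 : T → Label d) = 1 := by
  ext σ τ
  simp only [mon, Pi.zero_apply, site_zero, Matrix.one_apply, Finset.prod_ite_zero]
  simp [funext_iff]

lemma mon_mul_mon (g h : T → Label d) : mon g * mon h = phase g h • mon (g + h) := by
  ext σ τ
  simp only [Matrix.mul_apply, mon, Matrix.smul_apply, smul_eq_mul, phase, Pi.add_apply,
    ← Finset.prod_mul_distrib, ← sum_site_mul_site]
  rw [Fintype.prod_sum]

lemma symbol_mon (g h : T → Label d) : symbol g (mon h) = if g = h then 1 else 0 := by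
  simp only [symbol_apply, mon, ← Finset.prod_mul_distrib]
  rw [prod_sum_sum (fun t a b => dualSite (g t) a b * site (h t) a b)]
  simp only [sum_dualSite_mul_site, Finset.prod_ite_zero]
  simp [funext_iff]

lemma sum_symbol_smul_mon (X : Op d T) : ∑ g, symbol g X • mon g = X := by
  ext σ τ
  simp only [Matrix.sum_apply, Matrix.smul_apply, smul_eq_mul, symbol_apply, Finset.sum_mul]
  rw [Finset.sum_comm]
  have h : ∀ σ' τ' : T → Fin d,
      ∑ g : T → Label d, (∏ t, dualSite (g t) (σ' t) (τ' t)) * X σ' τ' * mon g σ τ =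
        if σ = σ' ∧ τ = τ' then X σ' τ' else 0 := by
    intro σ' τ'
    have h1 : ∀ g : T → Label d, (∏ t, dualSite (g t) (σ' t) (τ' t)) * X σ' τ' * mon g σ τ =
        (∏ t, site (g t) (σ t) (τ t) * dualSite (g t) (σ' t) (τ' t)) * X σ' τ' := by
      intro g
      rw [Finset.prod_mul_distrib, mon]; ring
    simp only [h1, ← Finset.sum_mul]
    rw [← Fintype.prod_sum fun t (α : Label d) => site α (σ t) (τ t) * dualSite α (σ' t) (τ' t)]
    have h3 : (∀ t ∈ Finset.univ, σ t = σ' t ∧ τ t = τ' t) ↔ σ = σ' ∧ τ = τ' := by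
      simp only [Finset.mem_univ, true_imp_iff, forall_and, funext_iff]
    simp only [sum_site_mul_dualSite, Finset.prod_ite_zero, h3]
    split_ifs <;> simp
  have h2 : ∀ σ' : T → Fin d, ∑ g : T → Label d, ∑ τ' : T → Fin d,
      (∏ t, dualSite (g t) (σ' t) (τ' t)) * X σ' τ' * mon g σ τ =
        if σ = σ' then X σ' τ else 0 := by
    intro σ'
    rw [Finset.sum_comm]
    simp only [h, ite_and]
    split_ifs <;> simp
  simp [h2]

lemma symbol_ext {X Y : Op d T} (h : ∀ g, symbol g X = symbol g Y) : X = Y := by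
  rw [← sum_symbol_smul_mon X, ← sum_symbol_smul_mon Y]
  simp [h]

lemma symbol_mul (g : T → Label d) (X Y : Op d T) :
    symbol g (X * Y) = ∑ h, phase h (g - h) * (symbol h X * symbol (g - h) Y) := by
  conv_lhs => rw [← sum_symbol_smul_mon X, ← sum_symbol_smul_mon Y]
  rw [Finset.sum_mul_sum]
  simp only [map_sum, smul_mul_smul_comm, mon_mul_mon, map_smul, symbol_mon, smul_eq_mul]
  refine Finset.sum_congr rfl fun h _ => ?_
  rw [Finset.sum_eq_single (g - h)]
  · simp; ring
  · intro k _ hk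
    have : g ≠ h + k := fun e => hk (by rw [e]; abel)
    simp [this]
  · simp

/-- `transport` as a linear map. -/
noncomputable def transportLin (f : S → T) : Op d S →ₗ[ℂ] Op d T where
  toFun := transport f
  map_add' X Y := by
    ext σ τ; simp only [transport, Matrix.add_apply]; split_ifs <;> simp
  map_smul' c X := by
    ext σ τ; simp only [transport, Matrix.smul_apply, RingHom.id_apply]; split_ifs <;> simp

lemma transportLin_apply (f : S → T) (X : Op d S) : transportLin f X = transport f X := rfl

lemma transport_mon {f : S → T} (hf : f.Injective) (g : S → Label d) :
    transport f (mon g) = mon (Function.extend f g 0) := by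
  classical
  ext σ τ
  simp only [transport, mon, Function.comp]
  have h : ∀ t, site (Function.extend f g 0 t) (σ t) (τ t) =
      if t ∈ Finset.univ.image f then site (Function.extend f g 0 t) (σ t) (τ t)
        else if σ t = τ t then 1 else 0 := by
    intro t
    split_ifs with h1 h2 <;> try rfl
    · rw [Function.extend_apply' _ _ _ (by simpa using h1)]; simp [site_zero, h2]
    · rw [Function.extend_apply' _ _ _ (by simpa using h1)]; simp [site_zero, h2]
  rw [Finset.prod_congr rfl fun t _ => h t, Finset.prod_ite]
  have h1 : ∏ t ∈ Finset.univ.filter (fun t => t ∈ Finset.univ.image f),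
      site (Function.extend f g 0 t) (σ t) (τ t) = ∏ s, site (g s) (σ (f s)) (τ (f s)) := by
    rw [Finset.filter_mem_eq_inter, Finset.univ_inter, Finset.prod_image fun a _ b _ e => hf e]
    simp [hf.extend_apply]
  rw [h1, Finset.prod_ite_zero]
  simp only [Finset.mem_filter, Finset.mem_univ, true_and, Finset.mem_image, Set.mem_range,
    Finset.prod_const_one, mul_ite, mul_one, mul_zero]

lemma symbol_transport {f : S → T} (hf : f.Injective) (X : Op d S) (g : T → Label d) :
    symbol g (transport f X) =
      if ∀ t, t ∉ Set.range f → g t = 0 then symbol (g ∘ f) X else 0 := by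
  classical
  conv_lhs => rw [← sum_symbol_smul_mon X]
  rw [← transportLin_apply]
  simp only [map_sum, map_smul, transportLin_apply, transport_mon hf, symbol_mon, smul_eq_mul,
    mul_ite, mul_one, mul_zero]
  have h : ∀ h : S → Label d, g = Function.extend f h 0 ↔
      (∀ t, t ∉ Set.range f → g t = 0) ∧ h = g ∘ f := by
    intro h
    constructor
    · rintro rfl
      refine ⟨fun t ht => Function.extend_apply' _ _ _ ht, ?_⟩
      funext s
      simp [hf.extend_apply]
    · rintro ⟨h1, rfl⟩
      funext t
      by_cases ht : t ∈ Set.range f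
      · obtain ⟨s, rfl⟩ := ht
        simp [hf.extend_apply]
      · rw [h1 t ht, Function.extend_apply' _ _ _ ht]; rfl
  simp only [h, ite_and]
  split_ifs <;> simp

/-- The dual of label 0 is the normalized trace, so the coefficient contains the partial trace of
`X` over `i` as a factor inside the remaining sums. -/
lemma symbol_eq_zero_of_siteTraceless {X : Op d T} (hX : SiteTraceless X) {g : T → Label d} {i : T}
    (hi : g i = 0) : symbol g X = 0 := by
  have hsplit : ∀ F : (T → Fin d) → ℂ, ∑ σ, F σ =
      ∑ σ' : {j // j ≠ i} → Fin d, ∑ a, F ((Equiv.funSplitAt i (Fin d)).symm (a, σ')) := by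
    intro F
    rw [← (Equiv.funSplitAt i (Fin d)).symm.sum_comp, Fintype.sum_prod_type, Finset.sum_comm]
  rw [symbol_apply, hsplit]
  simp only [hsplit (fun τ => _ * X _ τ)]
  refine Finset.sum_eq_zero fun σ' _ => ?_
  rw [Finset.sum_comm]
  refine Finset.sum_eq_zero fun τ' _ => ?_
  have hp : ∀ a b : Fin d, (∏ t, dualSite (g t) ((Equiv.funSplitAt i (Fin d)).symm (a, σ') t)
      ((Equiv.funSplitAt i (Fin d)).symm (b, τ') t)) = (if a = b then (d : ℂ)⁻¹ else 0) *
        ∏ t : {j // j ≠ i}, dualSite (g t) (σ' t) (τ' t) := by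
    intro a b
    rw [← Finset.mul_prod_erase _ _ (Finset.mem_univ i), hi, dualSite_zero]
    congr 1
    · simp [Equiv.funSplitAt, Equiv.piSplitAt]
    · rw [Finset.prod_subtype (p := fun j => j ≠ i) (F := inferInstance) _ (by simp)]
      refine Finset.prod_congr rfl fun t _ => ?_
      simp [Equiv.funSplitAt, Equiv.piSplitAt, t.2]
  simp only [hp, ite_mul, zero_mul, Finset.sum_ite_eq, Finset.mem_univ, if_true, ← Finset.mul_sum]
  refine mul_eq_zero_of_right _ ?_
  have := hX i ((Equiv.funSplitAt i (Fin d)).symm (0, σ')) ((Equiv.funSplitAt i (Fin d)).symm (0, τ'))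
  rw [← this]
  refine Finset.sum_congr rfl fun a _ => ?_
  congr 1 <;>
  · funext t
    by_cases ht : t = i
    · subst ht; simp [Equiv.funSplitAt, Equiv.piSplitAt]
    · simp [Equiv.funSplitAt, Equiv.piSplitAt, ht]

end Symbol

/-! ### Components in the product basis -/

section Component

variable {d : ℕ} [NeZero d]

/-- `component` as a linear map. -/
noncomputable def componentLin (A B : Finset ℤ) : Op d B →ₗ[ℂ] Op d A where
  toFun := component A
  map_add' X Y := by
    ext σ τ; simp [component, mul_add, Finset.sum_add_distrib]
  map_smul' c X := by
    ext σ τ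
    simp only [component, Matrix.smul_apply, smul_eq_mul, RingHom.id_apply, Finset.mul_sum]
    exact Finset.sum_congr rfl fun _ _ => Finset.sum_congr rfl fun _ _ => by ring

lemma componentLin_apply (A B : Finset ℤ) (X : Op d B) : componentLin A B X = component A X := rfl

/-- The inclusion of the sites of `A` into those of `B`. -/
def incl {A B : Finset ℤ} (h : A ⊆ B) (a : A) : B := ⟨a, h a.2⟩

lemma incl_injective {A B : Finset ℤ} (h : A ⊆ B) : (incl h).Injective := by
  intro a b e
  exact Subtype.ext (congrArg (fun b : B => (b : ℤ)) e)

open Classical in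
lemma component_mon {A B : Finset ℤ} (hAB : A ⊆ B) (g : B → Label d) :
    component A (mon g) =
      if ∀ b : B, g b ≠ 0 ↔ (b : ℤ) ∈ A then mon (g ∘ incl hAB) else 0 := by
  ext σ τ
  simp only [component, mon, ← Finset.prod_mul_distrib]
  rw [prod_sum_sum (fun (i : B) s t => (if h : (i : ℤ) ∈ A then
    tracelessKernel d (σ ⟨i, h⟩) (τ ⟨i, h⟩) s t else traceKernel d s t) * site (g i) s t)]
  have h1 : ∀ i : B, (∑ s, ∑ t, (if h : (i : ℤ) ∈ A then
      tracelessKernel d (σ ⟨i, h⟩) (τ ⟨i, h⟩) s t else traceKernel d s t) * site (g i) s t) =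
      if (g i ≠ 0 ↔ (i : ℤ) ∈ A) then
        (if h : (i : ℤ) ∈ A then site (g i) (σ ⟨i, h⟩) (τ ⟨i, h⟩) else 1) else 0 := by
    intro i
    by_cases h : (i : ℤ) ∈ A
    · simp only [h, dif_pos, sum_tracelessKernel_mul_site]
      by_cases h0 : g i = 0 <;> simp [h0]
    · simp only [h, dif_neg, not_false_iff, sum_traceKernel_mul_site]
      by_cases h0 : g i = 0 <;> simp [h0]
  simp only [h1, Finset.prod_ite_zero, Finset.mem_univ, true_imp_iff]
  split_ifs with hg
  · rw [← Finset.prod_subset (Finset.subset_univ (Finset.univ.image (incl hAB)))]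
    · rw [Finset.prod_image fun a _ b _ e => incl_injective hAB e]
      refine Finset.prod_congr rfl fun a _ => ?_
      simp [incl]
    · intro b _ hb
      have : (b : ℤ) ∉ A := by
        intro h
        exact hb (Finset.mem_image.2 ⟨⟨b, h⟩, Finset.mem_univ _, rfl⟩)
      simp [this]
  · rfl

-- Projecting to the component on `A` keeps exactly the basis operators whose nonzero labels fill
-- `A`; this is why `g` must have no zero label.
open Classical in
lemma symbol_component {A B : Finset ℤ} (hAB : A ⊆ B) (Y : Op d B) (g : A → Label d)
    (hg : ∀ a, g a ≠ 0) :
    symbol g (component A Y) = symbol (Function.extend (incl hAB) g 0) Y := by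
  conv_lhs => rw [← sum_symbol_smul_mon Y]
  rw [← componentLin_apply]
  simp only [map_sum, map_smul, componentLin_apply, component_mon hAB, smul_eq_mul, apply_ite,
    symbol_mon, map_zero, mul_one, mul_zero]
  rw [Finset.sum_eq_single (Function.extend (incl hAB) g 0)]
  · have h1 : g = Function.extend (incl hAB) g 0 ∘ incl hAB := by
      funext a; simp [(incl_injective hAB).extend_apply]
    have h2 : ∀ b : B, Function.extend (incl hAB) g 0 b ≠ 0 ↔ (b : ℤ) ∈ A := by
      intro b
      constructor
      · intro h
        by_contra hb
        refine h (Function.extend_apply' _ _ _ ?_)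
        rintro ⟨a, rfl⟩
        exact hb a.2
      · intro h
        have : b = incl hAB ⟨b, h⟩ := rfl
        rw [this, (incl_injective hAB).extend_apply]
        exact hg _
    rw [if_pos h2, if_pos h1]
  · intro h _ hne
    split_ifs with h1 h2 <;> try rfl
    exfalso
    apply hne
    funext b
    by_cases hb : (b : ℤ) ∈ A
    · have : b = incl hAB ⟨b, hb⟩ := rfl
      rw [this, (incl_injective hAB).extend_apply, h2]; rfl
    · rw [Function.extend_apply']
      · simpa using (h1 b).not.2 hb
      · rintro ⟨a, rfl⟩
        exact hb a.2
  · simp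

end Component

/-! ### Strings, their phases, and the twisted convolution -/

section Strings

variable {d : ℕ} [NeZero d]

lemma rootChar_neg_left (b t : Fin d) : rootChar (-b) t = rootChar b (-t) := by
  have i1 : rootChar (-b) t * rootChar b t = 1 := by rw [← rootChar_add_left]; simp
  have i2 : rootChar b (-t) * rootChar b t = 1 := by rw [← rootChar_add_right]; simp
  exact mul_right_cancel₀ (right_ne_zero_of_mul_eq_one i1) (i1.trans i2.symm)

/-- Labels of the product basis of the local operators on the infinite chain. -/
abbrev Str (d : ℕ) [NeZero d] : Type := ℤ →₀ Label d

/-- The bicharacter of strings that describes the product of basis operators. -/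
noncomputable def strPhase (g h : Str d) : ℂ := ∏ i ∈ g.support, rootChar (g i).2 (h i).1

lemma strPhase_eq_prod (g h : Str d) {s : Finset ℤ} (hs : g.support ⊆ s) :
    strPhase g h = ∏ i ∈ s, rootChar (g i).2 (h i).1 := by
  refine Finset.prod_subset hs fun i _ hi => ?_
  simp [Finsupp.notMem_support_iff.1 hi]

lemma strPhase_add_left (g g' h : Str d) :
    strPhase (g + g') h = strPhase g h * strPhase g' h := by
  rw [strPhase_eq_prod (g + g') h Finsupp.support_add,
    strPhase_eq_prod g h Finset.subset_union_left,
    strPhase_eq_prod g' h (Finset.subset_union_right (s₁ := g.support)), ← Finset.prod_mul_distrib]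
  exact Finset.prod_congr rfl fun i _ => by
    rw [Finsupp.add_apply, Prod.snd_add, rootChar_add_left]

lemma strPhase_add_right (g h h' : Str d) :
    strPhase g (h + h') = strPhase g h * strPhase g h' := by
  rw [strPhase, strPhase, strPhase, ← Finset.prod_mul_distrib]
  exact Finset.prod_congr rfl fun i _ => by
    rw [Finsupp.add_apply, Prod.fst_add, rootChar_add_right]

lemma strPhase_eq_one {g h : Str d} (H : ∀ i, g i = 0 ∨ h i = 0) : strPhase g h = 1 := by
  refine Finset.prod_eq_one fun i _ => ?_
  rcases H i with h | h <;> simp [h]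

/-- The structure constants of the commutator of basis operators. -/
noncomputable def lam (g h : Str d) : ℂ := strPhase g h - strPhase h g

lemma lam_swap (g h : Str d) : lam g h = -lam h g := by simp [lam]

lemma lam_eq_zero {g h : Str d} (H : ∀ i, g i = 0 ∨ h i = 0) : lam g h = 0 := by
  rw [lam, strPhase_eq_one H, strPhase_eq_one fun i => (H i).symm, sub_self]

lemma exists_of_lam_ne_zero {g h : Str d} (H : lam g h ≠ 0) : ∃ i, g i ≠ 0 ∧ h i ≠ 0 := by
  by_contra! hc
  exact H (lam_eq_zero fun i => or_iff_not_imp_left.2 (hc i))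

/-- If `g + h` vanishes on the support of `g`, then `h = -g` there and the two phases agree site by
site. Hence a factor must touch the support of the commutator, which makes `brk a b k` a finite sum
when only `a` has finite range. -/
lemma exists_add_of_lam_ne_zero {g h : Str d} (H : lam g h ≠ 0) :
    ∃ i, g i ≠ 0 ∧ (g + h) i ≠ 0 := by
  by_contra! hc
  apply H
  rw [lam, strPhase_eq_prod g h Finset.subset_union_left,
    strPhase_eq_prod h g (Finset.subset_union_right (s₁ := g.support)), sub_eq_zero]
  refine Finset.prod_congr rfl fun i _ => ?_
  by_cases hi : g i = 0
  · simp [hi]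
  · have : h i = -g i := by
      have := hc i hi
      rw [Finsupp.add_apply] at this
      exact eq_neg_of_add_eq_zero_right this
    rw [this, Prod.fst_neg, Prod.snd_neg, rootChar_neg_left]

lemma lam_jacobi (g h k : Str d) :
    lam g (h + k) * lam h k + lam h (k + g) * lam k g + lam k (g + h) * lam g h = 0 := by
  simp only [lam, strPhase_add_left, strPhase_add_right]
  ring

/-- Translation of strings. -/
noncomputable def translate (x : ℤ) : Str d ≃+ Str d := Finsupp.domCongr (Equiv.addRight x)

lemma translate_apply (x : ℤ) (k : Str d) (i : ℤ) : translate x k i = k (i - x) := by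
  simp [translate, sub_eq_add_neg]

lemma support_translate (x : ℤ) (k : Str d) : (translate x k).support = shift k.support x := by
  ext i
  simp only [Finsupp.mem_support_iff, translate_apply, shift, Finset.mem_image]
  constructor
  · intro h; exact ⟨i - x, h, by ring⟩
  · rintro ⟨j, hj, rfl⟩; simpa using hj

lemma translate_translate (x y : ℤ) (k : Str d) :
    translate x (translate y k) = translate (x + y) k := by
  ext1 i; simp only [translate_apply]; congr 1; ring

@[simp] lemma translate_zero_left (k : Str d) : translate 0 k = k := by
  ext1 i; simp [translate_apply]

lemma strPhase_translate (x : ℤ) (g h : Str d) :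
    strPhase (translate x g) (translate x h) = strPhase g h := by
  rw [strPhase, support_translate, shift, Finset.prod_image fun a _ b _ e => by simpa using e]
  simp [translate_apply, strPhase]

lemma lam_translate (x : ℤ) (g h : Str d) : lam (translate x g) (translate x h) = lam g h := by
  simp [lam, strPhase_translate]

/-- The strings supported in a finite window. -/
noncomputable def strings (W : Finset ℤ) : Finset (Str d) := W.finsupp fun _ => Finset.univ

lemma mem_strings {W : Finset ℤ} {k : Str d} : k ∈ strings W ↔ k.support ⊆ W := by
  rw [strings, Finset.mem_finsupp_iff]
  simp

/-- Coefficient functions all of whose strings have range at most `r`. -/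
def FinRange (r : ℕ) (a : Str d → ℂ) : Prop :=
  ∀ k, a k ≠ 0 → ∀ i j, k i ≠ 0 → k j ≠ 0 → j < i + r

/-- Translation invariance of coefficient functions. -/
def TransInv (a : Str d → ℂ) : Prop := ∀ x k, a (translate x k) = a k

/-- The commutator in terms of coefficient functions. -/
noncomputable def brk (a b : Str d → ℂ) (k : Str d) : ℂ :=
  ∑ᶠ g, lam g (k - g) * (a g * b (k - g))

/-- Labels on a window as strings. -/
noncomputable def extStr {W : Finset ℤ} (g : W → Label d) : Str d :=
  Finsupp.onFinset W (fun i => if h : i ∈ W then g ⟨i, h⟩ else 0) fun i hi => by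
    by_contra h
    simp [h] at hi

lemma extStr_apply {W : Finset ℤ} (g : W → Label d) (i : ℤ) :
    extStr g i = if h : i ∈ W then g ⟨i, h⟩ else 0 := rfl

lemma sum_strings {M : Type*} [AddCommMonoid M] {W : Finset ℤ} (F : (W → Label d) → M) :
    ∑ g, F g = ∑ k ∈ strings W, F (fun b => k b) := by
  refine Finset.sum_bij' (fun g _ => extStr g) (fun k _ => fun b => k b) ?_ ?_ ?_ ?_ ?_
  · intro g _
    rw [mem_strings]
    exact Finsupp.support_onFinset_subset
  · intro _ _; exact Finset.mem_univ _
  · intro g _; funext b; simp [extStr_apply]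
  · intro k hk
    ext1 i
    rw [extStr_apply]
    split_ifs with h
    · rfl
    · exact (Finsupp.notMem_support_iff.1 fun h' => h (mem_strings.1 hk h')).symm
  · intro g _
    congr 1
    funext b; simp [extStr_apply]

lemma phase_restrict {W : Finset ℤ} {g h : Str d} (hg : g.support ⊆ W) :
    phase (fun b : W => g b) (fun b : W => h b) = strPhase g h := by
  rw [strPhase_eq_prod g h hg, phase]
  exact Finset.prod_coe_sort W fun i => rootChar (g i).2 (h i).1

end Strings

/-! ### Formal operators as coefficient functions -/

section Coef

variable {d : ℕ} [NeZero d]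

/-- The coefficients of a formal operator in the product basis. -/
noncomputable def coef (Φ : FormalOp d) (k : Str d) : ℂ :=
  symbol (fun a : k.support => k a) (Φ.term k.support)

lemma symbol_term (Φ : FormalOp d) {A : Finset ℤ} {k : Str d} (h : k.support = A) :
    symbol (fun a : A => k a) (Φ.term A) = coef Φ k := by
  subst h; rfl

lemma coef_eq_zero_of_term {Φ : FormalOp d} {k : Str d} (h : Φ.term k.support = 0) :
    coef Φ k = 0 := by
  rw [coef, h, map_zero]

/-- Only `A = k.support` contributes: a set missing part of the support gives the identity where `k`
is nonzero, and a set with extra sites is killed by tracelessness there. -/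
lemma symbol_restrict (Φ : FormalOp d) {W : Finset ℤ} {k : Str d} (hk : k.support ⊆ W) :
    symbol (fun b : W => k b) (Φ.restrict W) = coef Φ k := by
  rw [FormalOp.restrict, map_sum, Finset.sum_eq_single ⟨k.support, Finset.mem_powerset.2 hk⟩]
  · refine (symbol_transport (incl_injective hk) _ _).trans ?_
    rw [if_pos]
    · rfl
    · intro t ht
      by_contra h
      exact ht ⟨⟨t, Finsupp.mem_support_iff.2 h⟩, rfl⟩
  · rintro ⟨A, hA⟩ _ hne
    refine (symbol_transport (incl_injective (Finset.mem_powerset.1 hA)) _ _).trans ?_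
    split_ifs with h
    · have h1 : k.support ⊆ A := by
        intro i hi
        by_contra hiA
        refine Finsupp.mem_support_iff.1 hi (h ⟨i, hk hi⟩ ?_)
        rintro ⟨a, ha⟩
        apply hiA
        have := congrArg (fun b : W => (b : ℤ)) ha
        simp only at this
        rw [← this]; exact a.2
      have h2 : ¬ A ⊆ k.support := fun h2 => hne (Subtype.ext (h2.antisymm h1))
      obtain ⟨i, hi, hik⟩ := Finset.not_subset.1 h2
      exact symbol_eq_zero_of_siteTraceless (Φ.siteTraceless A) (i := ⟨i, hi⟩)
        (Finsupp.notMem_support_iff.1 hik)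
    · rfl
  · intro h; exact absurd (Finset.mem_attach _ _) h

lemma symbol_lie {W : Finset ℤ} (X Y : Op d W) {k : Str d} (hk : k.support ⊆ W) :
    symbol (fun b : W => k b) ⁅X, Y⁆ = ∑ g ∈ strings W, lam g (k - g) *
      (symbol (fun b : W => g b) X * symbol (fun b : W => (k - g) b) Y) := by
  rw [Ring.lie_def, map_sub, symbol_mul, symbol_mul,
    ← (Equiv.subLeft (fun b : W => k b)).sum_comp (fun h => phase h _ * (symbol h Y * _)),
    ← Finset.sum_sub_distrib, sum_strings]
  refine Finset.sum_congr rfl fun g hg => ?_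
  have hg' := mem_strings.1 hg
  have hkg : (k - g).support ⊆ W := Finsupp.support_sub.trans (Finset.union_subset hk hg')
  have e : (fun b : W => k b) - (fun b : W => g b) = fun b : W => (k - g) b := by
    funext b; simp
  have e' : (fun b : W => k b) - (fun b : W => (k - g) b) = fun b : W => g b := by
    funext b; simp
  simp only [Equiv.subLeft_apply, e, e', lam]
  rw [phase_restrict hg', phase_restrict hkg]
  ring

lemma lt_of_setRange_le {A : Finset ℤ} {r : ℕ} (h : setRange A ≤ r) {i j : ℤ} (hi : i ∈ A)
    (hj : j ∈ A) : j < i + r := by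
  have hA : A.Nonempty := ⟨i, hi⟩
  rw [setRange, dif_pos hA] at h
  have h1 := A.min'_le i hi
  have h2 := A.le_max' j hj
  omega

lemma finRange_coef {Φ : FormalOp d} {r : ℕ} (h : ∀ A, Φ.term A ≠ 0 → setRange A ≤ r) :
    FinRange r (coef Φ) := by
  intro k hk i j hi hj
  exact lt_of_setRange_le (h _ fun h0 => hk (coef_eq_zero_of_term h0))
    (Finsupp.mem_support_iff.2 hi) (Finsupp.mem_support_iff.2 hj)

/-- The window in `FormalOp.comm` captures every contributing string of `Φ`, since such a string
meets the support of `k`. The bound `r` enters only to make the supremum `Φ.range` a genuine bound.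
-/
lemma coef_comm {Φ Ψ : FormalOp d} {r : ℕ} (h : ∀ A, Φ.term A ≠ 0 → setRange A ≤ r) :
    coef (Φ.comm Ψ) = brk (coef Φ) (coef Ψ) := by
  have hr : FinRange Φ.range (coef Φ) := by
    refine finRange_coef fun A hA => le_csSup ⟨r, ?_⟩ ⟨A, hA, rfl⟩
    rintro _ ⟨A, hA, rfl⟩
    exact h A hA
  funext k
  set W := thicken k.support Φ.range with hW
  have hkW : k.support ⊆ W := subset_thicken _ _
  have h1 : coef (Φ.comm Ψ) k = symbol (fun b : W => k b) ⁅Φ.restrict W, Ψ.restrict W⁆ := by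
    rw [coef, FormalOp.comm, symbol_component hkW _ _ fun a => Finsupp.mem_support_iff.1 a.2]
    congr 2
    funext b
    by_cases hb : (b : ℤ) ∈ k.support
    · have : b = incl hkW ⟨b, hb⟩ := rfl
      rw [this, (incl_injective hkW).extend_apply]; rfl
    · rw [Function.extend_apply', Finsupp.notMem_support_iff.1 hb]; · rfl
      rintro ⟨a, rfl⟩
      exact hb a.2
  rw [h1, symbol_lie _ _ hkW, brk, finsum_eq_sum_of_support_subset (s := strings W)]
  · refine Finset.sum_congr rfl fun g hg => ?_
    have hg' := mem_strings.1 hg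
    have hkg : (k - g).support ⊆ W := Finsupp.support_sub.trans (Finset.union_subset hkW hg')
    rw [symbol_restrict Φ hg', symbol_restrict Ψ hkg]
  · intro g hg
    rw [Function.mem_support] at hg
    have hl := left_ne_zero_of_mul hg
    have ha := left_ne_zero_of_mul (right_ne_zero_of_mul hg)
    obtain ⟨i, hi, hik⟩ := exists_add_of_lam_ne_zero hl
    rw [add_sub_cancel] at hik
    rw [Finset.mem_coe, mem_strings]
    intro j hj
    rw [Finsupp.mem_support_iff] at hj
    have h2 := hr g ha i j hi hj
    have h3 := hr g ha j i hj hi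
    rw [hW, thicken, Finset.mem_biUnion]
    exact ⟨i, Finsupp.mem_support_iff.2 hik, Finset.mem_Icc.2 ⟨by omega, by omega⟩⟩

lemma shiftMap_bijective (A : Finset ℤ) (x : ℤ) : (shiftMap A x).Bijective := by
  constructor
  · intro a b h
    have := congrArg (fun c : shift A x => (c : ℤ)) h
    simp only [shiftMap] at this
    exact Subtype.ext (by omega)
  · rintro ⟨c, hc⟩
    obtain ⟨a, ha, rfl⟩ := Finset.mem_image.1 hc
    exact ⟨⟨a, ha⟩, rfl⟩

lemma symbol_transport_shiftMap {A : Finset ℤ} {x : ℤ} (X : Op d A) (g : shift A x → Label d) :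
    symbol g (transport (shiftMap A x) X) = symbol (g ∘ shiftMap A x) X := by
  rw [symbol_transport (shiftMap_bijective A x).1, if_pos]
  intro t ht
  exact absurd ((shiftMap_bijective A x).2 t) ht

lemma isTranslationInvariant_iff (Φ : FormalOp d) :
    Φ.IsTranslationInvariant ↔ TransInv (coef Φ) := by
  have key : ∀ (x : ℤ) (k : Str d), coef Φ (translate x k) =
      symbol (fun b : shift k.support x => translate x k b) (Φ.term (shift k.support x)) := by
    intro x k
    exact (symbol_term Φ (support_translate x k)).symm
  have key2 : ∀ (x : ℤ) (k : Str d), coef Φ k = symbol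
      (fun b : shift k.support x => translate x k b)
        (transport (shiftMap k.support x) (Φ.term k.support)) := by
    intro x k
    rw [symbol_transport_shiftMap, coef]
    congr 2
    funext a
    simp [shiftMap, translate_apply]
  constructor
  · intro h x k
    rw [key, h, ← key2]
  · intro h A x
    refine symbol_ext fun g => ?_
    -- Labels with a zero give coefficient 0 on both sides by tracelessness; the others come from a
    -- string with support exactly `A`.
    by_cases hg : ∃ b, g b = 0
    · obtain ⟨b, hb⟩ := hg
      obtain ⟨a, rfl⟩ := (shiftMap_bijective A x).2 b
      rw [symbol_transport_shiftMap, symbol_eq_zero_of_siteTraceless (Φ.siteTraceless _) hb,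
        symbol_eq_zero_of_siteTraceless (Φ.siteTraceless _) (i := a) hb]
    · push Not at hg
      obtain ⟨k, hk⟩ : ∃ k : Str d, k = extStr (g ∘ shiftMap A x) := ⟨_, rfl⟩
      have hsupp : k.support = A := by
        ext i
        rw [Finsupp.mem_support_iff, hk, extStr_apply]
        constructor
        · intro h; by_contra hi; simp [hi] at h
        · intro hi; simp [hi, hg]
      subst hsupp
      have hgk : g = fun b : shift k.support x => translate x k b := by
        funext b
        obtain ⟨a, rfl⟩ := (shiftMap_bijective k.support x).2 b
        have : k (a : ℤ) = g (shiftMap k.support x a) := by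
          refine (DFunLike.congr_fun hk (a : ℤ)).trans ?_
          rw [extStr_apply]
          simp
        simp [translate_apply, shiftMap, this]
      rw [hgk, ← key, ← key2]
      exact h x k

end Coef

/-! ### Range, translation, Jacobi identity, and the range of the boosted commutator -/

section Bracket

variable {d : ℕ} [NeZero d]

lemma FinRange.mono {r s : ℕ} {a : Str d → ℂ} (ha : FinRange r a) (h : r ≤ s) : FinRange s a := by
  intro k hk i j hi hj
  have := ha k hk i j hi hj
  omega

lemma FinRange.add {r : ℕ} {a b : Str d → ℂ} (ha : FinRange r a) (hb : FinRange r b) :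
    FinRange r (a + b) := by
  intro k hk i j hi hj
  by_cases h : a k = 0
  · exact hb k (by simpa [h] using hk) i j hi hj
  · exact ha k h i j hi hj

lemma support_subset_thicken {r : ℕ} {a : Str d → ℂ} (ha : FinRange r a) {g k : Str d}
    (hg : a g ≠ 0) (hl : lam g (k - g) ≠ 0) : g.support ⊆ thicken k.support r := by
  obtain ⟨i, hi, hik⟩ := exists_add_of_lam_ne_zero hl
  rw [add_sub_cancel] at hik
  intro j hj
  rw [Finsupp.mem_support_iff] at hj
  have h2 := ha g hg i j hi hj
  have h3 := ha g hg j i hj hi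
  rw [thicken, Finset.mem_biUnion]
  exact ⟨i, Finsupp.mem_support_iff.2 hik, Finset.mem_Icc.2 ⟨by omega, by omega⟩⟩

lemma support_brk_subset {r : ℕ} {a : Str d → ℂ} (ha : FinRange r a) (b : Str d → ℂ) (k : Str d) :
    (Function.support fun g => lam g (k - g) * (a g * b (k - g))) ⊆
      (strings (thicken k.support r) : Finset (Str d)) := by
  intro g hg
  rw [Function.mem_support] at hg
  exact mem_strings.2 (support_subset_thicken ha
    (left_ne_zero_of_mul (right_ne_zero_of_mul hg)) (left_ne_zero_of_mul hg))

lemma finite_support_brk {r : ℕ} {a : Str d → ℂ} (ha : FinRange r a) (b : Str d → ℂ) (k : Str d) :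
    (Function.support fun g => lam g (k - g) * (a g * b (k - g))).Finite :=
  (Finset.finite_toSet _).subset (support_brk_subset ha b k)

lemma brk_swap (a b : Str d → ℂ) : brk a b = -brk b a := by
  funext k
  rw [Pi.neg_apply, brk, brk, ← finsum_neg_distrib, ← finsum_comp_equiv (Equiv.subLeft k)]
  refine finsum_congr fun g => ?_
  rw [Equiv.subLeft_apply, sub_sub_cancel, lam_swap]
  ring

lemma brk_self (a : Str d → ℂ) : brk a a = 0 := by
  have := brk_swap a a
  funext k
  have h := congrFun this k
  simp only [Pi.neg_apply] at h
  simp only [Pi.zero_apply]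
  linear_combination h / 2

lemma brk_zero_right (a : Str d → ℂ) : brk a 0 = 0 := by
  funext k; simp [brk]

lemma brk_zero_left (a : Str d → ℂ) : brk 0 a = 0 := by
  funext k; simp [brk]

lemma brk_apply_zero (a b : Str d → ℂ) : brk a b 0 = 0 := by
  refine finsum_eq_zero_of_forall_eq_zero fun g => mul_eq_zero_of_left ?_ _
  by_contra h
  obtain ⟨i, _, hi⟩ := exists_add_of_lam_ne_zero h
  simp at hi

lemma brk_add_left {r : ℕ} {a b c : Str d → ℂ} (ha : FinRange r a) (hb : FinRange r b) :
    brk (a + b) c = brk a c + brk b c := by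
  funext k
  rw [Pi.add_apply, brk, brk, brk,
    ← finsum_add_distrib (finite_support_brk ha c k) (finite_support_brk hb c k)]
  exact finsum_congr fun g => by rw [Pi.add_apply]; ring

lemma brk_add_right {r : ℕ} {a b c : Str d → ℂ} (ha : FinRange r a) :
    brk a (b + c) = brk a b + brk a c := by
  funext k
  rw [Pi.add_apply, brk, brk, brk,
    ← finsum_add_distrib (finite_support_brk ha b k) (finite_support_brk ha c k)]
  exact finsum_congr fun g => by rw [Pi.add_apply]; ring

lemma exists_of_brk_ne_zero {a b : Str d → ℂ} {k : Str d} (h : brk a b k ≠ 0) :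
    ∃ g, lam g (k - g) ≠ 0 ∧ a g ≠ 0 ∧ b (k - g) ≠ 0 := by
  by_contra! hc
  refine h (finsum_eq_zero_of_forall_eq_zero fun g => ?_)
  by_cases h1 : lam g (k - g) = 0
  · rw [h1, zero_mul]
  · by_cases h2 : a g = 0
    · rw [h2, zero_mul, mul_zero]
    · rw [hc g h1 h2, mul_zero, mul_zero]

/-- Two strings that fail to commute share a site, so that site is counted once in the combined
range. -/
lemma FinRange.brk {r s : ℕ} {a b : Str d → ℂ} (ha : FinRange (r + 1) a) (hb : FinRange (s + 1) b) :
    FinRange (r + s + 1) (SpinChain.brk a b) := by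
  intro k hk i j hi hj
  obtain ⟨g, hl, hag, hbg⟩ := exists_of_brk_ne_zero hk
  obtain ⟨m, hm1, hm2⟩ := exists_of_lam_ne_zero hl
  have key : ∀ i, k i ≠ 0 → g i ≠ 0 ∨ (k - g) i ≠ 0 := by
    intro i hi
    by_contra! hc
    apply hi
    rw [← sub_add_cancel k g, Finsupp.add_apply, hc.1, hc.2, add_zero]
  have A := ha g hag
  have B := hb (k - g) hbg
  push_cast at A B ⊢
  rcases key i hi with h1 | h1 <;> rcases key j hj with h2 | h2
  · have := A i j h1 h2; omega
  · have := A i m h1 hm1; have := B m j hm2 h2; omega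
  · have := B i m h1 hm2; have := A m j hm1 h2; omega
  · have := B i j h1 h2; omega

/-- The affine form serves two purposes: `z = 0` is translation invariance, and `z = x` with `a'`
the Hamiltonian is the behaviour of the boost. -/
lemma brk_translate {r : ℕ} {a a' b : Str d → ℂ} {x : ℤ} {z : ℂ} (ha : FinRange r a)
    (ha' : FinRange r a') (h : ∀ g : Str d, a (translate x g) = a g + z * a' g) (hb : TransInv b)
    (k : Str d) : brk a b (translate x k) = brk a b k + z * brk a' b k := by
  rw [brk, brk, brk, mul_finsum, ← finsum_add_distrib (finite_support_brk ha b k)]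
  · rw [← finsum_comp_equiv (translate (d := d) x).toEquiv]
    refine finsum_congr fun g => ?_
    simp only [AddEquiv.toEquiv_eq_coe, EquivLike.coe_coe]
    rw [← map_sub, lam_translate, h, hb]
    ring
  · refine (finite_support_brk ha' b k).subset fun g hg => ?_
    exact right_ne_zero_of_mul hg

lemma TransInv.brk {r : ℕ} {a b : Str d → ℂ} (hr : FinRange r a) (ha : TransInv a)
    (hb : TransInv b) : TransInv (SpinChain.brk a b) := by
  intro x k
  have := brk_translate (z := 0) hr hr (x := x) (fun g => by rw [ha, zero_mul, add_zero]) hb k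
  rw [this, zero_mul, add_zero]

/-- Sums over the decompositions of a string into three strings. -/
noncomputable def tripleSum (k : Str d) (F : Str d → Str d → Str d → ℂ) : ℂ :=
  ∑ᶠ p : Str d × Str d, F p.1 p.2 (k - p.1 - p.2)

/-- Finiteness of the support of the summand in `tripleSum`. -/
def TripleFinite (k : Str d) (F : Str d → Str d → Str d → ℂ) : Prop :=
  (Function.support fun p : Str d × Str d => F p.1 p.2 (k - p.1 - p.2)).Finite

/-- The rotation of the decompositions of a string into three strings. -/
noncomputable def rotEquiv (k : Str d) : Str d × Str d ≃ Str d × Str d where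
  toFun p := (p.2, k - p.1 - p.2)
  invFun p := (k - p.1 - p.2, p.1)
  left_inv p := Prod.ext (by simp only; abel) rfl
  right_inv p := Prod.ext rfl (by simp only; abel)

lemma tripleSum_rot (k : Str d) (F : Str d → Str d → Str d → ℂ) :
    tripleSum k (fun x y z => F y z x) = tripleSum k F := by
  refine (finsum_congr fun p => ?_).trans (finsum_comp_equiv (rotEquiv k))
  have : k - p.2 - (k - p.1 - p.2) = p.1 := by abel
  simp [rotEquiv, this]

lemma tripleSum_swap (k : Str d) (F : Str d → Str d → Str d → ℂ) :
    tripleSum k (fun x y z => F y x z) = tripleSum k F := by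
  refine (finsum_congr fun p => ?_).trans (finsum_comp_equiv (Equiv.prodComm (Str d) (Str d)))
  simp [sub_right_comm]

lemma TripleFinite.rot {k : Str d} {F : Str d → Str d → Str d → ℂ} (h : TripleFinite k F) :
    TripleFinite k (fun x y z => F y z x) := by
  refine (h.preimage (rotEquiv k).injective.injOn).subset fun p hp => ?_
  have : k - p.2 - (k - p.1 - p.2) = p.1 := by abel
  simpa [rotEquiv, this] using hp

lemma TripleFinite.swap {k : Str d} {F : Str d → Str d → Str d → ℂ} (h : TripleFinite k F) :
    TripleFinite k (fun x y z => F y x z) := by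
  refine (h.preimage (Equiv.prodComm (Str d) (Str d)).injective.injOn).subset fun p hp => ?_
  simpa [sub_right_comm] using hp

lemma TripleFinite.add {k : Str d} {F G : Str d → Str d → Str d → ℂ} (h : TripleFinite k F)
    (h' : TripleFinite k G) : TripleFinite k (F + G) :=
  (h.union h').subset (Function.support_add _ _)

lemma tripleSum_add {k : Str d} {F G : Str d → Str d → Str d → ℂ} (h : TripleFinite k F)
    (h' : TripleFinite k G) : tripleSum k (F + G) = tripleSum k F + tripleSum k G :=
  finsum_add_distrib h h'

/-- The structure constants of the nested commutator. -/
noncomputable def nest (x y z : Str d) : ℂ := lam x (y + z) * lam y z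

lemma nest_swap (x y z : Str d) : nest x z y = -nest x y z := by
  rw [nest, nest, lam_swap z y, add_comm z y]; ring

lemma nest_jacobi (x y z : Str d) : nest x y z + nest y z x + nest z x y = 0 := lam_jacobi x y z

/-- The string `x` must touch `k`, and then `y` must touch `k - x`; this confines both to finite
windows and fixes `z`, so `c` may have any range. -/
lemma tripleFinite_nest {r : ℕ} {a b : Str d → ℂ} (ha : FinRange r a) (hb : FinRange r b)
    (c : Str d → ℂ) (k : Str d) :
    TripleFinite k (fun x y z => nest x y z * (a x * b y * c z)) := by
  set W := thicken k.support r
  refine ((strings W) ×ˢ (strings (thicken W r))).finite_toSet.subset ?_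
  rintro ⟨x, y⟩ hp
  simp only [Function.mem_support, nest] at hp
  have h1 := left_ne_zero_of_mul hp
  have h2 := left_ne_zero_of_mul (right_ne_zero_of_mul hp)
  have e : y + (k - x - y) = k - x := by abel
  rw [e] at h1
  have hx : x.support ⊆ W :=
    support_subset_thicken ha (left_ne_zero_of_mul h2) (left_ne_zero_of_mul h1)
  have hy := support_subset_thicken hb (right_ne_zero_of_mul h2) (right_ne_zero_of_mul h1)
  have hkx : (k - x).support ⊆ W :=
    Finsupp.support_sub.trans (Finset.union_subset (subset_thicken _ _) hx)
  rw [Finset.mem_coe, Finset.mem_product, mem_strings, mem_strings]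
  exact ⟨hx, hy.trans (Finset.biUnion_subset_biUnion_of_subset_left _ hkx)⟩

lemma brk_brk {r : ℕ} {a b : Str d → ℂ} (ha : FinRange r a) (hb : FinRange r b)
    (c : Str d → ℂ) (k : Str d) :
    brk a (brk b c) k = tripleSum k (fun x y z => nest x y z * (a x * b y * c z)) := by
  rw [tripleSum, finsum_curry _ (tripleFinite_nest ha hb c k), brk]
  refine finsum_congr fun x => ?_
  rw [brk, mul_finsum, mul_finsum]
  refine finsum_congr fun y => ?_
  have e : y + (k - x - y) = k - x := by abel
  simp only [nest, e]
  ring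

/-- All three double commutators are sums over decompositions `k = x + y + z`. After permuting the
summation variables the identity holds termwise by `nest_jacobi`. -/
lemma brk_jacobi {r : ℕ} {a b c : Str d → ℂ} (ha : FinRange r a) (hb : FinRange r b)
    (hc : FinRange r c) : brk a (brk b c) = brk (brk a b) c + brk b (brk a c) := by
  funext k
  rw [brk_swap (brk a b) c, Pi.add_apply, Pi.neg_apply, brk_brk ha hb, brk_brk hb ha, brk_brk hc ha]
  have F1 := tripleFinite_nest ha hb c k
  have F3 := (tripleFinite_nest hc ha b k).rot.rot
  rw [eq_neg_add_iff_add_eq, add_comm, ← tripleSum_rot k (fun x y z => _ * (c x * a y * b z)),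
    ← tripleSum_rot k (fun x y z => nest y z x * _), ← tripleSum_swap k fun x y z => _ * (b x * _ * _),
    ← tripleSum_add F1 F3]
  refine finsum_congr fun p => ?_
  simp only [Pi.add_apply]
  generalize k - p.1 - p.2 = z
  have h1 := nest_jacobi p.1 p.2 z
  have h2 := nest_swap p.2 p.1 z
  linear_combination (a p.1 * b p.2 * c z) * (h1 - h2)

lemma brk_neg_right (a b : Str d → ℂ) : brk a (-b) = -brk a b := by
  funext k
  rw [Pi.neg_apply, brk, brk, ← finsum_neg_distrib]
  exact finsum_congr fun g => by rw [Pi.neg_apply]; ring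

/-- Among three strings on neighbouring pairs of sites with two strings at distance two, the
nested commutators, weighted by the differences of the positions, add up to zero. -/
lemma nest_weighted_aux {x y z : Str d} {p q r : ℤ} (hx : ∀ i, x i ≠ 0 → i = p ∨ i = p + 1)
    (hy : ∀ i, y i ≠ 0 → i = q ∨ i = q + 1) (hz : ∀ i, z i ≠ 0 → i = r ∨ i = r + 1)
    (hpq : p + 2 ≤ q) :
    nest x y z * (q - r : ℂ) + nest y z x * (r - p) + nest z x y * (p - q) = 0 := by
  have hxy : ∀ i, x i ≠ 0 → y i = 0 := by
    intro i hi
    by_contra h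
    have := hx i hi
    have := hy i h
    omega
  have hl : lam x y = 0 := lam_eq_zero fun i => or_iff_not_imp_left.2 (hxy i)
  have h3 : nest z x y = 0 := by rw [nest, hl, mul_zero]
  have conn : ∀ {u v : Str d}, (∀ i, u i ≠ 0 → v i = 0) → lam u (v + z) ≠ 0 →
      ∃ i, u i ≠ 0 ∧ z i ≠ 0 := by
    intro u v huv h
    obtain ⟨i, hi, hi'⟩ := exists_of_lam_ne_zero h
    exact ⟨i, hi, by simpa [huv i hi] using hi'⟩
  have hyx : ∀ i, y i ≠ 0 → x i = 0 := fun i hi => by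
    by_contra h; exact hi (hxy i h)
  -- As `x` and `y` are disjoint, a surviving term needs `z` to touch both, so `z` exactly bridges
  -- the gap. The two remaining weights are then both 1, and the plain Jacobi identity finishes.
  have main : (nest x y z ≠ 0 ∨ nest y z x ≠ 0) → r = p + 1 ∧ q = p + 2 := by
    intro h
    have h' : (∃ i, x i ≠ 0 ∧ z i ≠ 0) ∧ (∃ i, y i ≠ 0 ∧ z i ≠ 0) := by
      rcases h with h | h
      · exact ⟨conn hxy (left_ne_zero_of_mul h), exists_of_lam_ne_zero (right_ne_zero_of_mul h)⟩
      · obtain ⟨i, h1, h2⟩ := exists_of_lam_ne_zero (right_ne_zero_of_mul h)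
        have h4 := left_ne_zero_of_mul h
        rw [add_comm] at h4
        exact ⟨⟨i, h2, h1⟩, conn hyx h4⟩
    obtain ⟨⟨i, h1, h2⟩, j, h4, h5⟩ := h'
    have := hx i h1
    have := hz i h2
    have := hy j h4
    have := hz j h5
    omega
  by_cases h : nest x y z ≠ 0 ∨ nest y z x ≠ 0
  · obtain ⟨rfl, rfl⟩ := main h
    have := nest_jacobi x y z
    push_cast
    rw [h3] at this ⊢
    linear_combination this
  · push Not at h
    rw [h.1, h.2, h3]; ring

/-- Were all positions pairwise within distance one, the sum would live on three consecutive sites.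
So some two positions differ by at least two, and permuting the strings reduces to
`nest_weighted_aux`. -/
lemma nest_weighted {x y z : Str d} {p q r : ℤ} (hx : ∀ i, x i ≠ 0 → i = p ∨ i = p + 1)
    (hy : ∀ i, y i ≠ 0 → i = q ∨ i = q + 1) (hz : ∀ i, z i ≠ 0 → i = r ∨ i = r + 1)
    {i j : ℤ} (hi : (x + y + z) i ≠ 0) (hj : (x + y + z) j ≠ 0) (hij : i + 3 ≤ j) :
    nest x y z * (q - r : ℂ) + nest y z x * (r - p) + nest z x y * (p - q) = 0 := by
  have key : ∀ i, (x + y + z) i ≠ 0 → (i = p ∨ i = p + 1) ∨ (i = q ∨ i = q + 1) ∨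
      (i = r ∨ i = r + 1) := by
    intro i hi
    by_contra! h
    apply hi
    have h1 : x i = 0 := by by_contra h'; have := hx i h'; omega
    have h2 : y i = 0 := by by_contra h'; have := hy i h'; omega
    have h3 : z i = 0 := by by_contra h'; have := hz i h'; omega
    simp [h1, h2, h3]
  have hi' := key i hi
  have hj' := key j hj
  have s1 := nest_swap x y z
  have s2 := nest_swap y z x
  have s3 := nest_swap z x y
  have cases : p + 2 ≤ q ∨ q + 2 ≤ p ∨ p + 2 ≤ r ∨ r + 2 ≤ p ∨ q + 2 ≤ r ∨ r + 2 ≤ q := by omega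
  rcases cases with h | h | h | h | h | h
  · exact nest_weighted_aux hx hy hz h
  · have := nest_weighted_aux hy hx hz h
    rw [s1, s2, s3] at this
    linear_combination this
  · have := nest_weighted_aux hx hz hy h
    rw [s1, s2, s3] at this
    linear_combination this
  · have := nest_weighted_aux hz hx hy h
    linear_combination this
  · have := nest_weighted_aux hy hz hx h
    linear_combination this
  · have := nest_weighted_aux hz hy hx h
    rw [s1, s2, s3] at this
    linear_combination this

/-- For a nearest-neighbour operator `h` at positions `m`, the iterated commutator of `h` with its
boost has range at most three. -/
lemma brk_brk_boost {h : Str d → ℂ} {m : Str d → ℤ} (hh : FinRange 2 h)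
    (hm : ∀ g, h g ≠ 0 → ∀ i, g i ≠ 0 → i = m g ∨ i = m g + 1) :
    FinRange 3 (brk h (brk (fun g => (m g : ℂ) * h g) h)) := by
  intro k hk i j hi hj
  by_contra hij
  apply hk
  have hb : FinRange 2 (fun g => (m g : ℂ) * h g) := fun g hg => hh g (right_ne_zero_of_mul hg)
  rw [brk_brk hh hb]
  set F : Str d → Str d → Str d → ℂ :=
    fun x y z => nest x y z * (h x * (m y * h y) * h z) with hF
  have F1 : TripleFinite k F := tripleFinite_nest hh hb h k
  have F2 := F1.add F1.swap.rot
  have S2 : tripleSum k (F + fun x y z => F z y x) = 2 * tripleSum k F := by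
    rw [tripleSum_add F1 F1.swap.rot, tripleSum_rot k (fun x y z => F y x z), tripleSum_swap, two_mul]
  -- `G` and its two rotations run through all six orderings of the strings. Antisymmetry of `nest`
  -- in its last two arguments turns the symmetrized summand into position differences, as in
  -- `nest_weighted`.
  set G : Str d → Str d → Str d → ℂ := F + fun x y z => F z y x with hG
  have S3 : tripleSum k ((G + fun x y z => G y z x) + fun x y z => G z x y) =
      2 * tripleSum k F + 2 * tripleSum k F + 2 * tripleSum k F := by
    rw [tripleSum_add (F2.add F2.rot) F2.rot.rot, tripleSum_add F2 F2.rot,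
      tripleSum_rot k (fun x y z => G y z x), tripleSum_rot k G, S2]
  refine (mul_eq_zero.1 ((?_ : (6 : ℂ) * tripleSum k F = 0))).resolve_left (by norm_num)
  rw [show (6 : ℂ) * tripleSum k F = 2 * tripleSum k F + 2 * tripleSum k F + 2 * tripleSum k F by ring,
    ← S3]
  refine finsum_eq_zero_of_forall_eq_zero fun p => ?_
  obtain ⟨z, hz⟩ : ∃ z, z = k - p.1 - p.2 := ⟨_, rfl⟩
  have hk' : k = p.1 + p.2 + z := by rw [hz]; abel
  simp only [Pi.add_apply, hG, hF, ← hz]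
  generalize p.1 = x at *
  generalize p.2 = y at *
  by_cases h0 : h x * h y * h z = 0
  · linear_combination (nest x y z * m y + nest z y x * m y + nest y z x * m z + nest x z y * m z +
      nest z x y * m x + nest y x z * m x) * h0
  · have hx := hm x (left_ne_zero_of_mul (left_ne_zero_of_mul h0))
    have hy := hm y (right_ne_zero_of_mul (left_ne_zero_of_mul h0))
    have hz := hm z (right_ne_zero_of_mul h0)
    rw [hk'] at hi hj
    have := nest_weighted hx hy hz hi hj (by push_cast at hij; omega)
    rw [nest_swap x y z, nest_swap y z x, nest_swap z x y]
    linear_combination (h x * h y * h z) * this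

end Bracket

/-! ### Wrapping strings around the periodic chain -/

section Ring

variable {d : ℕ} [NeZero d] {N : ℕ} [NeZero N]

/-- The labels on the periodic chain obtained by wrapping a string around the chain. -/
noncomputable def wrap (N : ℕ) (k : Str d) (z : ZMod N) : Label d :=
  ∑ i ∈ k.support with ((i : ℤ) : ZMod N) = z, k i

lemma wrap_eq_sum (k : Str d) {s : Finset ℤ} (hs : k.support ⊆ s) (z : ZMod N) :
    wrap N k z = ∑ i ∈ s with ((i : ℤ) : ZMod N) = z, k i := by
  refine Finset.sum_subset (Finset.filter_subset_filter _ hs) fun i hi hi' => ?_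
  rw [Finset.mem_filter] at hi hi'
  by_contra h
  exact hi' ⟨Finsupp.mem_support_iff.2 h, hi.2⟩

lemma wrap_add (g h : Str d) : wrap N (g + h) = wrap N g + wrap N h := by
  funext z
  rw [Pi.add_apply, wrap_eq_sum (g + h) Finsupp.support_add,
    wrap_eq_sum g Finset.subset_union_left,
    wrap_eq_sum h (Finset.subset_union_right (s₁ := g.support)), ← Finset.sum_add_distrib]
  rfl

@[simp] lemma wrap_zero : wrap N (0 : Str d) = 0 := by
  funext z; simp [wrap]

lemma exists_of_wrap_ne_zero {k : Str d} {z : ZMod N} (h : wrap N k z ≠ 0) :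
    ∃ i : ℤ, (i : ZMod N) = z ∧ k i ≠ 0 := by
  obtain ⟨i, hi, _⟩ := Finset.exists_ne_zero_of_sum_ne_zero h
  rw [Finset.mem_filter, Finsupp.mem_support_iff] at hi
  exact ⟨i, hi.2, hi.1⟩

lemma intCast_injOn : Set.InjOn (fun i : ℤ => (i : ZMod N)) (Finset.Icc (1 : ℤ) N) := by
  intro i hi j hj h
  rw [Finset.mem_coe, Finset.mem_Icc] at hi hj
  rw [ZMod.intCast_eq_intCast_iff_dvd_sub] at h
  obtain ⟨c, hc⟩ := h
  have : c = 0 := by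
    by_contra h0
    rcases lt_or_gt_of_ne h0 with h1 | h1 <;> nlinarith
  subst this
  linarith

lemma wrap_apply_intCast {k : Str d} (hk : k ∈ strings (Finset.Icc (1 : ℤ) N)) {i : ℤ}
    (hi : i ∈ Finset.Icc (1 : ℤ) N) : wrap N k (i : ZMod N) = k i := by
  rw [wrap_eq_sum k (mem_strings.1 hk), Finset.sum_eq_single i]
  · intro j hj hne
    rw [Finset.mem_filter] at hj
    exact absurd (intCast_injOn (Finset.mem_coe.2 hj.1) (Finset.mem_coe.2 hi) hj.2) hne
  · intro h
    simp [hi] at h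

/-- Rotation of labels on the periodic chain. -/
def rot (x : ZMod N) (κ : ZMod N → Label d) (z : ZMod N) : Label d := κ (z - x)

lemma rot_rot (x y : ZMod N) (κ : ZMod N → Label d) : rot x (rot y κ) = rot (x + y) κ := by
  funext z; simp only [rot]; congr 1; ring

@[simp] lemma rot_zero (κ : ZMod N → Label d) : rot 0 κ = κ := by
  funext z; simp [rot]

lemma rot_add (x : ZMod N) (κ κ' : ZMod N → Label d) : rot x (κ + κ') = rot x κ + rot x κ' := rfl

lemma wrap_translate (x : ℤ) (k : Str d) : wrap N (translate x k) = rot (x : ZMod N) (wrap N k) := by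
  funext z
  rw [rot, wrap, wrap, support_translate, shift, Finset.filter_image,
    Finset.sum_image fun a _ b _ e => by simpa using e]
  refine Finset.sum_congr ?_ fun i _ => by simp [translate_apply]
  refine Finset.filter_congr fun i _ => ?_
  push_cast
  exact eq_sub_iff_add_eq.symm

lemma extend_eq_wrap {A : Finset ℤ} (hA : A ⊆ Finset.Icc (1 : ℤ) N) {k : Str d}
    (hk : k.support ⊆ A) (x : ZMod N) :
    Function.extend (fun a : A => ((a : ℤ) : ZMod N) + x) (fun a : A => k a) 0 =
      rot x (wrap N k) := by
  have hinj : Function.Injective (fun a : A => ((a : ℤ) : ZMod N) + x) := by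
    intro a b h
    exact Subtype.ext (intCast_injOn (Finset.mem_coe.2 (hA a.2)) (Finset.mem_coe.2 (hA b.2))
      (add_right_cancel h))
  funext z
  by_cases hz : ∃ a : A, ((a : ℤ) : ZMod N) + x = z
  · obtain ⟨a, rfl⟩ := hz
    rw [hinj.extend_apply (fun a : A => k a) 0 a, rot, add_sub_cancel_right,
      wrap_apply_intCast (mem_strings.2 (hk.trans hA)) (hA a.2)]
  · rw [Function.extend_apply' _ _ _ hz]
    by_contra h
    obtain ⟨i, hi, hki⟩ := exists_of_wrap_ne_zero (Ne.symm h)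
    exact hz ⟨⟨i, hk (Finsupp.mem_support_iff.2 hki)⟩, by simp only [hi]; ring⟩

lemma term_eq_sum (Φ : FormalOp d) (A : Finset ℤ) :
    Φ.term A = ∑ k ∈ strings A with k.support = A, coef Φ k • mon (fun a : A => k a) := by
  conv_lhs => rw [← sum_symbol_smul_mon (Φ.term A), sum_strings]
  rw [Finset.sum_filter]
  refine Finset.sum_congr rfl fun k hk => ?_
  split_ifs with h
  · rw [symbol_term Φ h]
  · obtain ⟨i, hi, hik⟩ := Finset.not_subset.1 fun h' => h ((mem_strings.1 hk).antisymm h')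
    have h0 := symbol_eq_zero_of_siteTraceless (Φ.siteTraceless A) (g := fun b : A => k b)
      (i := ⟨i, hi⟩) (Finsupp.notMem_support_iff.1 hik)
    rw [h0, zero_smul]

lemma transport_term (Φ : FormalOp d) {A : Finset ℤ} (hA : A ⊆ Finset.Icc (1 : ℤ) N) (x : ZMod N) :
    transport (fun a : A => ((a : ℤ) : ZMod N) + x) (Φ.term A) =
      ∑ k ∈ strings A with k.support = A, coef Φ k • mon (rot x (wrap N k)) := by
  have hinj : Function.Injective (fun a : A => ((a : ℤ) : ZMod N) + x) := by
    intro a b h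
    exact Subtype.ext (intCast_injOn (Finset.mem_coe.2 (hA a.2)) (Finset.mem_coe.2 (hA b.2))
      (add_right_cancel h))
  rw [← transportLin_apply, term_eq_sum, map_sum]
  refine Finset.sum_congr rfl fun k hk => ?_
  rw [map_smul, transportLin_apply, transport_mon hinj,
    extend_eq_wrap hA (mem_strings.1 (Finset.mem_filter.1 hk).1)]

/-- The sum of the rotations of a basis operator on the periodic chain. -/
noncomputable def orbitSum (κ : ZMod N → Label d) : Op d (ZMod N) := ∑ x, mon (rot x κ)

lemma orbitSum_rot (x : ZMod N) (κ : ZMod N → Label d) : orbitSum (rot x κ) = orbitSum κ := by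
  simp only [orbitSum, rot_rot]
  exact Equiv.sum_comp (Equiv.addRight x) fun y => mon (rot y κ)

/-- The strings in `{1, …, N}` that start at the site `1`. -/
noncomputable def firstStrings (d N : ℕ) [NeZero d] : Finset (Str d) :=
  (strings (Finset.Icc (1 : ℤ) N)).filter fun k => k 1 ≠ 0

lemma mem_firstStrings {k : Str d} :
    k ∈ firstStrings d N ↔ k.support ⊆ Finset.Icc (1 : ℤ) N ∧ k 1 ≠ 0 := by
  rw [firstStrings, Finset.mem_filter, mem_strings]

/-- The operator on the periodic chain with given coefficients. -/
noncomputable def ringOp (N : ℕ) [NeZero N] (a : Str d → ℂ) : Op d (ZMod N) :=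
  a 0 • 1 + ∑ k ∈ firstStrings d N, a k • orbitSum (wrap N k)

lemma finiteSize_eq (Φ : FormalOp d) : Φ.finiteSize N = ringOp N (coef Φ) := by
  rw [FormalOp.finiteSize, ringOp]
  congr 1
  · have h := transport_term (N := N) Φ (Finset.empty_subset _) 0
    simp only [add_zero] at h
    rw [h]
    have : (strings (d := d) ∅).filter (fun k => k.support = ∅) = {0} := by
      ext k
      simp [mem_strings]
    rw [this, Finset.sum_singleton, wrap_zero, rot_zero, mon_zero]
  · simp only [orbitSum, Finset.smul_sum]
    rw [Finset.sum_comm (s := firstStrings d N)]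
    refine Finset.sum_congr rfl fun x _ => ?_
    rw [← Finset.sum_fiberwise_of_maps_to (s := firstStrings d N)
      (t := (Finset.Icc (1 : ℤ) N).powerset.filter fun A => (1 : ℤ) ∈ A) (g := fun k => k.support)]
    · refine Finset.sum_congr rfl fun A hA => ?_
      rw [Finset.mem_filter, Finset.mem_powerset] at hA
      rw [transport_term Φ hA.1]
      refine Finset.sum_congr ?_ fun _ _ => rfl
      ext k
      simp only [Finset.mem_filter, mem_strings, mem_firstStrings]
      constructor
      · rintro ⟨_, rfl⟩
        exact ⟨⟨hA.1, Finsupp.mem_support_iff.1 hA.2⟩, rfl⟩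
      · rintro ⟨_, rfl⟩
        exact ⟨subset_rfl, rfl⟩
    · intro k hk
      rw [mem_firstStrings] at hk
      rw [Finset.mem_filter, Finset.mem_powerset]
      exact ⟨hk.1, Finsupp.mem_support_iff.2 hk.2⟩

lemma symbol_orbitSum (g κ : ZMod N → Label d) :
    symbol g (orbitSum κ) = ∑ x, if g = rot x κ then 1 else 0 := by
  simp only [orbitSum, map_sum, symbol_mon]

/-- On a sufficiently long periodic chain the coefficients are determined by the operator. -/
lemma eq_zero_of_ringOp_eq_zero {r : ℕ} {a : Str d → ℂ} (ha : FinRange r a) (ht : TransInv a)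
    (h0 : a 0 = 0) (hN : 2 * r ≤ N + 1) (h : ringOp N a = 0) : a = 0 := by
  have hsmall : ∀ k, a k ≠ 0 → k 1 ≠ 0 → ∀ i, k i ≠ 0 → i < 1 + r := fun k hk h1 i hi =>
    ha k hk 1 i h1 hi
  have key : ∀ k ∈ firstStrings d N, a k = 0 := by
    intro k hk
    by_contra hak
    have hk' := mem_firstStrings.1 hk
    have h1 : symbol (wrap N k) (ringOp N a) = 0 := by rw [h, map_zero]
    have h1N : (1 : ℤ) ∈ Finset.Icc (1 : ℤ) N :=
      Finset.mem_Icc.2 ⟨le_rfl, by exact_mod_cast NeZero.one_le⟩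
    have main : ∀ g ∈ firstStrings d N, a g ≠ 0 → ∀ x : ZMod N, wrap N k = rot x (wrap N g) →
        x = 0 ∧ g = k := by
      intro g hg hag x hx
      have hg' := mem_firstStrings.1 hg
      have e1 : wrap N k ((1 : ℤ) : ZMod N) ≠ 0 := by
        rw [wrap_apply_intCast (mem_strings.2 hk'.1) h1N]; exact hk'.2
      have e2 : wrap N g ((1 : ℤ) : ZMod N) ≠ 0 := by
        rw [wrap_apply_intCast (mem_strings.2 hg'.1) h1N]; exact hg'.2
      rw [hx, rot] at e1
      obtain ⟨i, hi, hgi⟩ := exists_of_wrap_ne_zero e1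
      have e3 : wrap N k (((1 : ℤ) : ZMod N) + x) ≠ 0 := by
        rw [hx, rot, add_sub_cancel_right]; exact e2
      obtain ⟨j, hj, hkj⟩ := exists_of_wrap_ne_zero e3
      have b1 := hsmall g hag hg'.2 i hgi
      have b2 := hsmall k hak hk'.2 j hkj
      have b3 := Finset.mem_Icc.1 (hg'.1 (Finsupp.mem_support_iff.2 hgi))
      have b4 := Finset.mem_Icc.1 (hk'.1 (Finsupp.mem_support_iff.2 hkj))
      -- Modulo `N`, `i` is `1 - x` and `j` is `1 + x`, while 0 ≤ i + j - 2 ≤ 2(r - 1) < N. So `i =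
      -- j = 1` and `x = 0`: distinct starting strings have disjoint orbits, and no nontrivial
      -- rotation fixes one.
      have hsum : ((i + j - 2 : ℤ) : ZMod N) = 0 := by
        push_cast; rw [hi, hj]; push_cast; ring
      rw [ZMod.intCast_zmod_eq_zero_iff_dvd] at hsum
      have hz : i + j - 2 = 0 := Int.eq_zero_of_dvd_of_nonneg_of_lt (by omega) (by omega) hsum
      have hi1 : i = 1 := by omega
      have hx0 : x = 0 := by
        rw [hi1] at hi
        have := sub_eq_self.1 hi.symm
        exact this
      refine ⟨hx0, ?_⟩
      rw [hx0, rot_zero] at hx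
      ext1 l
      by_cases hl : l ∈ Finset.Icc (1 : ℤ) N
      · rw [← wrap_apply_intCast (mem_strings.2 hg'.1) hl,
          ← wrap_apply_intCast (mem_strings.2 hk'.1) hl, hx]
      · rw [Finsupp.notMem_support_iff.1 fun h => hl (hg'.1 h),
          Finsupp.notMem_support_iff.1 fun h => hl (hk'.1 h)]
    rw [ringOp, h0, zero_smul, zero_add, map_sum, Finset.sum_eq_single k] at h1
    · rw [map_smul, symbol_orbitSum, Finset.sum_eq_single 0] at h1
      · simp [hak] at h1
      · intro x _ hx
        rw [if_neg fun h => hx (main k hk hak x h).1]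
      · simp
    · intro g hg hne
      by_cases hag : a g = 0
      · rw [hag, zero_smul, map_zero]
      · rw [map_smul, symbol_orbitSum, Finset.sum_eq_zero, smul_zero]
        intro x _
        rw [if_neg fun h => hne (main g hg hag x h).2]
    · intro h; exact absurd hk h
  funext k
  by_contra hak
  have hk0 : k.support.Nonempty := by
    rw [Finsupp.support_nonempty_iff]
    rintro rfl
    exact hak h0
  set m := k.support.min' hk0 with hm
  have hkm : k m ≠ 0 := Finsupp.mem_support_iff.1 (k.support.min'_mem hk0)
  apply hak
  rw [Pi.zero_apply, ← ht (1 - m)]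
  refine key _ (mem_firstStrings.2 ⟨?_, ?_⟩)
  · intro i hi
    rw [Finsupp.mem_support_iff, translate_apply] at hi
    have h1 := ha k hak m _ hkm hi
    have h2 := k.support.min'_le _ (Finsupp.mem_support_iff.2 hi)
    rw [← hm] at h2
    have : r ≤ N := by have := NeZero.one_le (n := N); omega
    exact Finset.mem_Icc.2 ⟨by omega, by omega⟩
  · rw [translate_apply]
    simpa using hkm

end Ring

/-! ### Commutator phases on the ring as sums over lifts to the infinite chain -/

/-- If at most one pair of factors differs from `(1, 1)`, the difference of the products is the sum
of the differences. -/
lemma prod_sub_prod_eq_sum {ι : Type*} [DecidableEq ι] (F : Finset ι) (P Q : ι → ℂ)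
    (h : ∀ s ∈ F, ∀ t ∈ F, ¬ (P s = 1 ∧ Q s = 1) → ¬ (P t = 1 ∧ Q t = 1) → s = t) :
    ∏ s ∈ F, P s - ∏ s ∈ F, Q s = ∑ s ∈ F, (P s - Q s) := by
  by_cases hs : ∃ s ∈ F, ¬ (P s = 1 ∧ Q s = 1)
  · obtain ⟨s, hsF, hs⟩ := hs
    have h1 : ∀ t ∈ F, t ≠ s → P t = 1 ∧ Q t = 1 := by
      intro t ht hne
      by_contra hc
      exact hne (h t ht s hsF hc hs)
    rw [Finset.prod_eq_single s (fun t ht hne => (h1 t ht hne).1) fun h => absurd hsF h,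
      Finset.prod_eq_single s (fun t ht hne => (h1 t ht hne).2) fun h => absurd hsF h,
      Finset.sum_eq_single s (fun t ht hne => by rw [(h1 t ht hne).1, (h1 t ht hne).2, sub_self])
        fun h => absurd hsF h]
  · push Not at hs
    rw [Finset.prod_eq_one fun t ht => (hs t ht).1, Finset.prod_eq_one fun t ht => (hs t ht).2,
      Finset.sum_eq_zero fun t ht => by rw [(hs t ht).1, (hs t ht).2, sub_self], sub_self]

lemma map_sum_of_add_of_zero {ι A : Type*} [AddCommMonoid A] (f : A → ℂ) (h0 : f 0 = 1)
    (hadd : ∀ a b, f (a + b) = f a * f b) (s : Finset ι) (u : ι → A) :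
    f (∑ i ∈ s, u i) = ∏ i ∈ s, f (u i) := by
  classical
  induction s using Finset.induction_on with
  | empty => simpa using h0
  | insert i s hi ih => rw [Finset.sum_insert hi, Finset.prod_insert hi, hadd, ih]

section Ring

variable {d : ℕ} [NeZero d] {N : ℕ} [NeZero N]

/-- The translations by at most `N` sites in a given residue class. -/
noncomputable def lifts (x : ZMod N) : Finset ℤ :=
  (Finset.Icc (-N : ℤ) N).filter fun s => (s : ZMod N) = x

/-- Bimultiplicativity expands each factor over pairs of sites `i`, `j` lying over related ring
sites; grouping by `s = j - i` gives the product over lifts. It is stated for a general `B` so as to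
cover both orders of multiplication. -/
lemma prod_wrap (B : Label d → Label d → ℂ) (hl0 : ∀ β, B 0 β = 1) (hr0 : ∀ α, B α 0 = 1)
    (hl : ∀ α α' β, B (α + α') β = B α β * B α' β) (hr : ∀ α β β', B α (β + β') = B α β * B α β')
    {g h : Str d} (hg : g.support ⊆ Finset.Icc (1 : ℤ) N) (hh : h.support ⊆ Finset.Icc (1 : ℤ) N)
    (x : ZMod N) :
    ∏ z, B (rot x (wrap N g) z) (wrap N h z) =
      ∏ s ∈ lifts x, ∏ j ∈ h.support, B (g (j - s)) (h j) := by
  have h1 : ∀ z, B (rot x (wrap N g) z) (wrap N h z) =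
      ∏ j ∈ h.support with ((j : ℤ) : ZMod N) = z,
        ∏ i ∈ g.support with ((i : ℤ) : ZMod N) = (j : ZMod N) - x, B (g i) (h j) := by
    intro z
    rw [wrap, map_sum_of_add_of_zero _ (hr0 _) (hr _)]
    refine Finset.prod_congr rfl fun j hj => ?_
    rw [(Finset.mem_filter.1 hj).2, rot, wrap,
      map_sum_of_add_of_zero (fun α => B α (h j)) (hl0 _) fun α α' => hl α α' _]
  rw [Finset.prod_congr rfl fun z _ => h1 z, Finset.prod_fiberwise, Finset.prod_comm]
  refine Finset.prod_congr rfl fun j hj => ?_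
  have hj' := Finset.mem_Icc.1 (hh hj)
  have himg : ∏ i ∈ g.support with ((i : ℤ) : ZMod N) = (j : ZMod N) - x, B (g i) (h j) =
      ∏ s ∈ (g.support.filter fun i : ℤ => (i : ZMod N) = (j : ZMod N) - x).image (fun i => j - i),
        B (g (j - s)) (h j) := by
    rw [Finset.prod_image fun a _ b _ e => by simpa using e]
    exact Finset.prod_congr rfl fun i _ => by rw [sub_sub_cancel]
  rw [himg]
  refine Finset.prod_subset ?_ ?_
  · intro s hs
    obtain ⟨i, hi, rfl⟩ := Finset.mem_image.1 hs
    rw [Finset.mem_filter] at hi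
    have hi' := Finset.mem_Icc.1 (hg hi.1)
    rw [lifts, Finset.mem_filter, Finset.mem_Icc]
    refine ⟨⟨by omega, by omega⟩, ?_⟩
    push_cast
    rw [hi.2]; ring
  · intro s hs hs'
    have : g (j - s) = 0 := by
      by_contra h0
      refine hs' (Finset.mem_image.2 ⟨j - s, ?_, by ring⟩)
      rw [Finset.mem_filter, Finsupp.mem_support_iff]
      refine ⟨h0, ?_⟩
      push_cast
      rw [(Finset.mem_filter.1 hs).2]
    rw [this, hl0]

/-- The structure constants of the commutator on the periodic chain. -/
noncomputable def ringLam (g h : ZMod N → Label d) : ℂ := phase g h - phase h g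

lemma lie_mon (g h : ZMod N → Label d) : ⁅mon g, mon h⁆ = ringLam g h • mon (g + h) := by
  rw [Ring.lie_def, mon_mul_mon, mon_mul_mon, add_comm h g, ← sub_smul, ringLam]

lemma phase_rot (x : ZMod N) (g h : ZMod N → Label d) :
    phase (rot x g) (rot x h) = phase g h :=
  Equiv.prod_comp (Equiv.subRight x) fun z => rootChar (g z).2 (h z).1

lemma ringLam_rot (x : ZMod N) (g h : ZMod N → Label d) :
    ringLam (rot x g) (rot x h) = ringLam g h := by
  rw [ringLam, ringLam, phase_rot, phase_rot]

/-- On so long a ring at most one lift of `g` overlaps `h`, so only one factor of the phase products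
is nontrivial and the difference of products linearizes. -/
lemma ringLam_wrap {n m : ℕ} (hnm : n + m ≤ N + 1) {g h : Str d}
    (hg : g.support ⊆ Finset.Icc (1 : ℤ) N) (hh : h.support ⊆ Finset.Icc (1 : ℤ) N)
    (hgn : ∀ i j, g i ≠ 0 → g j ≠ 0 → j < i + n) (hhm : ∀ i j, h i ≠ 0 → h j ≠ 0 → j < i + m)
    (x : ZMod N) :
    ringLam (rot x (wrap N g)) (wrap N h) = ∑ s ∈ lifts x, lam (translate s g) h := by
  have e1 : phase (rot x (wrap N g)) (wrap N h) = ∏ s ∈ lifts x, strPhase (translate s g) h := by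
    refine (prod_wrap (fun α β => rootChar α.2 β.1) ?_ ?_ ?_ ?_ hg hh x).trans ?_
    · simp
    · simp
    · intro α α' β; rw [Prod.snd_add, rootChar_add_left]
    · intro α β β'; rw [Prod.fst_add, rootChar_add_right]
    · refine Finset.prod_congr rfl fun s _ => ?_
      rw [strPhase_eq_prod _ _ (Finset.subset_union_left (s₂ := h.support))]
      simp only [translate_apply]
      refine Finset.prod_subset Finset.subset_union_right fun i _ hi => ?_
      simp [Finsupp.notMem_support_iff.1 hi]
  have e2 : phase (wrap N h) (rot x (wrap N g)) = ∏ s ∈ lifts x, strPhase h (translate s g) := by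
    refine (prod_wrap (fun α β => rootChar β.2 α.1) ?_ ?_ ?_ ?_ hg hh x).trans ?_
    · simp
    · simp
    · intro α α' β; rw [Prod.fst_add, rootChar_add_right]
    · intro α β β'; rw [Prod.snd_add, rootChar_add_left]
    · refine Finset.prod_congr rfl fun s _ => ?_
      simp only [strPhase, translate_apply]
  rw [ringLam, e1, e2]
  refine prod_sub_prod_eq_sum _ _ _ ?_
  have meet : ∀ s, ¬ (strPhase (translate s g) h = 1 ∧ strPhase h (translate s g) = 1) →
      ∃ i, g (i - s) ≠ 0 ∧ h i ≠ 0 := by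
    intro s hs
    by_contra! hc
    have : ∀ i, translate s g i = 0 ∨ h i = 0 := fun i => by
      rw [translate_apply]; exact or_iff_not_imp_left.2 (hc i)
    exact hs ⟨strPhase_eq_one this, strPhase_eq_one fun i => (this i).symm⟩
  intro s hs t ht h1 h2
  obtain ⟨i, hi, hi'⟩ := meet s h1
  obtain ⟨j, hj, hj'⟩ := meet t h2
  have b1 := hgn _ _ hi hj
  have b2 := hgn _ _ hj hi
  have b3 := hhm _ _ hi' hj'
  have b4 := hhm _ _ hj' hi'
  -- The overlaps give |s - t| ≤ (n - 1) + (m - 1) < N.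
  have hst : ((s - t : ℤ) : ZMod N) = 0 := by
    push_cast
    rw [(Finset.mem_filter.1 hs).2, (Finset.mem_filter.1 ht).2, sub_self]
  rw [ZMod.intCast_zmod_eq_zero_iff_dvd] at hst
  have := Int.eq_zero_of_abs_lt_dvd hst (by rw [abs_lt]; omega)
  omega

/-- Every nonzero string of range at most `N` is, in exactly one way, a translate of a string in {1,
…, N} that starts at 1. -/
lemma firstStrings_unfold {M : Type*} [AddCommGroup M] {F : Str d → M}
    (hF : (Function.support F).Finite)
    (hr : ∀ k, F k ≠ 0 → k ≠ 0 ∧ ∀ i j, k i ≠ 0 → k j ≠ 0 → j < i + N) :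
    ∑ᶠ k, F k = ∑ k ∈ firstStrings d N, ∑ᶠ t : ℤ, F (translate t k) := by
  set e : firstStrings d N × ℤ → Str d := fun p => translate p.2 p.1 with he
  have inj : e.Injective := by
    have aux : ∀ p q, e p = e q → q.2 ≤ p.2 := by
      rintro ⟨⟨k, hk⟩, t⟩ ⟨⟨g, hg⟩, s⟩ h
      rw [mem_firstStrings] at hk hg
      have h1 := DFunLike.congr_fun h (1 + t)
      simp only [he, translate_apply, add_sub_cancel_right] at h1
      have h2 := Finset.mem_Icc.1 (hg.1 (Finsupp.mem_support_iff.2 (h1 ▸ hk.2)))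
      simp only
      omega
    intro p q h
    have h2 : p.2 = q.2 := le_antisymm (aux q p h.symm) (aux p q h)
    refine Prod.ext (Subtype.ext ?_) h2
    simp only [he, h2] at h
    exact (translate q.2).injective h
  have hrange : Function.support F ⊆ Set.range e := by
    intro k hk
    obtain ⟨h0, hk⟩ := hr k hk
    have hk0 : k.support.Nonempty := Finsupp.support_nonempty_iff.2 h0
    set m := k.support.min' hk0 with hm
    have hkm : k m ≠ 0 := Finsupp.mem_support_iff.1 (k.support.min'_mem hk0)
    refine ⟨(⟨translate (1 - m) k, mem_firstStrings.2 ⟨?_, ?_⟩⟩, m - 1), ?_⟩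
    · intro i hi
      rw [Finsupp.mem_support_iff, translate_apply] at hi
      have h1 := hk m _ hkm hi
      have h2 := k.support.min'_le _ (Finsupp.mem_support_iff.2 hi)
      rw [← hm] at h2
      exact Finset.mem_Icc.2 ⟨by omega, by omega⟩
    · rw [translate_apply]
      simpa using hkm
    · simp [he, translate_translate]
  have h1 : ∑ᶠ k, F k = ∑ᶠ p, F (e p) := by
    rw [← finsum_mem_range inj, ← finsum_mem_univ]
    exact finsum_mem_inter_support_eq' _ _ _ fun k hk => by simp [hrange hk]
  rw [h1, finsum_curry, finsum_eq_sum_of_fintype]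
  · exact Finset.sum_coe_sort (firstStrings d N) fun k => ∑ᶠ t : ℤ, F (translate t k)
  · exact hF.preimage inj.injOn

end Ring

/-! ### Commutators on the ring, and Hermiticity -/

section Ring

lemma ring_lie_sum {ι R : Type*} [Ring R] (x : R) (s : Finset ι) (f : ι → R) :
    ⁅x, ∑ i ∈ s, f i⁆ = ∑ i ∈ s, ⁅x, f i⁆ := by
  simp only [Ring.lie_def, Finset.mul_sum, Finset.sum_mul, Finset.sum_sub_distrib]

lemma ring_sum_lie {ι R : Type*} [Ring R] (x : R) (s : Finset ι) (f : ι → R) :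
    ⁅∑ i ∈ s, f i, x⁆ = ∑ i ∈ s, ⁅f i, x⁆ := by
  simp only [Ring.lie_def, Finset.mul_sum, Finset.sum_mul, Finset.sum_sub_distrib]

lemma ring_smul_lie_smul {R : Type*} [Ring R] [Algebra ℂ R] (c c' : ℂ) (x y : R) :
    ⁅c • x, c' • y⁆ = (c * c') • ⁅x, y⁆ := by
  simp only [Ring.lie_def, smul_mul_smul_comm, mul_comm c' c, smul_sub]

variable {d : ℕ} [NeZero d] {N : ℕ} [NeZero N]

/-- The phase depends only on the relative rotation, so the common rotation can be summed out. -/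
lemma lie_orbitSum (κ κ' : ZMod N → Label d) :
    ⁅orbitSum κ, orbitSum κ'⁆ = ∑ x, ringLam (rot x κ) κ' • orbitSum (rot x κ + κ') := by
  have h1 : ⁅orbitSum κ, orbitSum κ'⁆ =
      ∑ y, ∑ x, ringLam (rot x κ) κ' • mon (rot y (rot x κ + κ')) := by
    rw [orbitSum, orbitSum, ring_lie_sum]
    refine Finset.sum_congr rfl fun y _ => ?_
    rw [ring_sum_lie, ← Equiv.sum_comp (Equiv.addRight y)]
    refine Finset.sum_congr rfl fun x _ => ?_
    simp only [Equiv.coe_addRight]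
    rw [lie_mon, add_comm x y, ← rot_rot, ringLam_rot, rot_add]
  rw [h1, Finset.sum_comm]
  exact Finset.sum_congr rfl fun x _ => by rw [orbitSum, Finset.smul_sum]

/-- The contribution of a pair of strings to the commutator on the periodic chain. -/
noncomputable def pairTerm (N : ℕ) [NeZero N] (a b : Str d → ℂ) (g h : Str d) : Op d (ZMod N) :=
  (lam g h * (a g * b h)) • orbitSum (wrap N (g + h))

lemma pairTerm_ne_zero {a b : Str d → ℂ} {g h : Str d} (H : pairTerm N a b g h ≠ 0) :
    lam g h ≠ 0 ∧ a g ≠ 0 ∧ b h ≠ 0 := by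
  have := left_ne_zero_of_smul H
  exact ⟨left_ne_zero_of_mul this, left_ne_zero_of_mul (right_ne_zero_of_mul this),
    right_ne_zero_of_mul (right_ne_zero_of_mul this)⟩

lemma pairTerm_translate {a b : Str d → ℂ} (ha : TransInv a) (hb : TransInv b) (x : ℤ)
    (g h : Str d) :
    pairTerm N a b (translate x g) (translate x h) = pairTerm N a b g h := by
  rw [pairTerm, pairTerm, lam_translate, ha, hb, ← map_add, wrap_translate, orbitSum_rot]

lemma lie_orbitSum_wrap {n m : ℕ} {a b : Str d → ℂ} (ha : FinRange (n + 1) a)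
    (hb : FinRange (m + 1) b) (hta : TransInv a) (hN : n + m + 1 ≤ N) {g h : Str d}
    (hg : g ∈ firstStrings d N) (hh : h ∈ firstStrings d N) :
    ⁅a g • orbitSum (wrap N g), b h • orbitSum (wrap N h)⁆ =
      ∑ᶠ s : ℤ, pairTerm N a b (translate s g) h := by
  rw [mem_firstStrings] at hg hh
  by_cases hag : a g = 0
  · rw [ring_smul_lie_smul, hag, zero_mul, zero_smul, finsum_eq_zero_of_forall_eq_zero]
    intro s
    rw [pairTerm, hta, hag, zero_mul, mul_zero, zero_smul]
  by_cases hbh : b h = 0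
  · rw [ring_smul_lie_smul, hbh, mul_zero, zero_smul, finsum_eq_zero_of_forall_eq_zero]
    intro s
    rw [pairTerm, hbh, mul_zero, mul_zero, zero_smul]
  rw [finsum_eq_sum_of_support_subset (s := Finset.Icc (-N : ℤ) N),
    ← Finset.sum_fiberwise (Finset.Icc (-N : ℤ) N) (fun s : ℤ => (s : ZMod N)), 
    ring_smul_lie_smul, lie_orbitSum, Finset.smul_sum]
  · refine Finset.sum_congr rfl fun x _ => ?_
    rw [ringLam_wrap (n := n + 1) (m := m + 1) (by omega) hg.1 hh.1 (ha g hag) (hb h hbh),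
      Finset.sum_smul, Finset.smul_sum]
    refine Finset.sum_congr rfl fun s hs => ?_
    rw [pairTerm, wrap_add, wrap_translate, (Finset.mem_filter.1 hs).2, hta, smul_smul]
    congr 1
    ring
  · intro s hs
    obtain ⟨i, hi, hi'⟩ := exists_of_lam_ne_zero (pairTerm_ne_zero hs).1
    rw [translate_apply] at hi
    have h1 := Finset.mem_Icc.1 (hg.1 (Finsupp.mem_support_iff.2 hi))
    have h2 := Finset.mem_Icc.1 (hh.1 (Finsupp.mem_support_iff.2 hi'))
    exact Finset.mem_coe.2 (Finset.mem_Icc.2 ⟨by omega, by omega⟩)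

lemma finite_support_pairTerm {r : ℕ} {a : Str d → ℂ} (ha : FinRange r a) (b : Str d → ℂ)
    (h : Str d) : (Function.support fun g => pairTerm N a b g h).Finite := by
  refine (strings (thicken h.support r)).finite_toSet.subset fun g hg => ?_
  obtain ⟨h1, h2, _⟩ := pairTerm_ne_zero hg
  obtain ⟨i, hi, hi'⟩ := exists_of_lam_ne_zero h1
  rw [Finset.mem_coe, mem_strings]
  intro j hj
  rw [Finsupp.mem_support_iff] at hj
  have h3 := ha g h2 i j hi hj
  have h4 := ha g h2 j i hj hi
  rw [thicken, Finset.mem_biUnion]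
  exact ⟨i, Finsupp.mem_support_iff.2 hi', Finset.mem_Icc.2 ⟨by omega, by omega⟩⟩

lemma range_pairTerm {n m : ℕ} {a b : Str d → ℂ} (ha : FinRange (n + 1) a)
    (hb : FinRange (m + 1) b) {k h : Str d} (H : pairTerm N a b (k - h) h ≠ 0) :
    k ≠ 0 ∧ ∀ i j, k i ≠ 0 → k j ≠ 0 → j < i + (n + m + 1 : ℕ) := by
  obtain ⟨hl, hag, hbh⟩ := pairTerm_ne_zero H
  constructor
  · rintro rfl
    obtain ⟨i, _, hi⟩ := exists_add_of_lam_ne_zero hl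
    simp at hi
  · intro i j hi hj
    obtain ⟨l, hl1, hl2⟩ := exists_of_lam_ne_zero hl
    have key : ∀ i, k i ≠ 0 → (k - h) i ≠ 0 ∨ h i ≠ 0 := by
      intro i hi
      by_contra! hc
      apply hi
      rw [← sub_add_cancel k h, Finsupp.add_apply, hc.1, hc.2, add_zero]
    have A := ha _ hag
    have B := hb _ hbh
    push_cast at A B ⊢
    rcases key i hi with h1 | h1 <;> rcases key j hj with h2 | h2
    · have := A i j h1 h2; omega
    · have := A i l h1 hl1; have := B l j hl2 h2; omega
    · have := B i l h1 hl2; have := A l j hl1 h2; omega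
    · have := B i j h1 h2; omega

lemma brk_smul_orbitSum {r : ℕ} {a : Str d → ℂ} (ha : FinRange r a) (b : Str d → ℂ) (k : Str d) :
    brk a b k • orbitSum (wrap N k) = ∑ᶠ h, pairTerm N a b (k - h) h := by
  rw [brk, finsum_smul' (finite_support_brk ha b k), ← finsum_comp_equiv (Equiv.subLeft k)]
  refine finsum_congr fun h => ?_
  rw [Equiv.subLeft_apply, pairTerm, sub_sub_cancel, sub_add_cancel]

/-- The commutator of operators on the periodic chain is given by the commutator on the infinite
chain if the chain is long enough. -/
theorem lie_ringOp {n m : ℕ} {a b : Str d → ℂ} (ha : FinRange (n + 1) a)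
    (hb : FinRange (m + 1) b) (hta : TransInv a) (htb : TransInv b) (hN : n + m + 1 ≤ N) :
    ⁅ringOp N a, ringOp N b⁆ = ringOp N (brk a b) := by
  have hfin := finite_support_pairTerm (N := N) ha b
  have h1 : ⁅ringOp N a, ringOp N b⁆ =
      ⁅∑ k ∈ firstStrings d N, a k • orbitSum (wrap N k),
        ∑ k ∈ firstStrings d N, b k • orbitSum (wrap N k)⁆ := by
    have aux : ∀ (c c' : ℂ) (X Y : Op d (ZMod N)), ⁅c • 1 + X, c' • 1 + Y⁆ = ⁅X, Y⁆ := by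
      intro c c' X Y
      simp only [Ring.lie_def, add_mul, mul_add, smul_mul_assoc, mul_smul_comm, one_mul, mul_one,
        smul_add, smul_comm c' c]
      abel
    exact aux _ _ _ _
  rw [h1, ring_lie_sum, ringOp, brk_apply_zero, zero_smul, zero_add]
  -- For fixed `h`, the starting strings `g` and their lifts assemble into all strings. The sum is
  -- then reindexed by the total string `k = g + h` and folded again, now according to where `k`
  -- starts.
  have h2 : ∀ h ∈ firstStrings d N, ⁅∑ k ∈ firstStrings d N, a k • orbitSum (wrap N k),
      b h • orbitSum (wrap N h)⁆ =
        ∑ k ∈ firstStrings d N, ∑ᶠ t : ℤ, pairTerm N a b (translate t k - h) h := by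
    intro h hh
    rw [ring_sum_lie, Finset.sum_congr rfl fun g hg => lie_orbitSum_wrap ha hb hta hN hg hh,
      ← firstStrings_unfold (F := fun g => pairTerm N a b g h) (hfin h),
      ← finsum_comp_equiv (Equiv.subRight h)]
    · refine firstStrings_unfold (F := fun k => pairTerm N a b (k - h) h) ?_ ?_
      · exact (hfin h).preimage (Equiv.subRight h).injective.injOn
      · intro k hk
        obtain ⟨h3, h4⟩ := range_pairTerm ha hb hk
        refine ⟨h3, fun i j hi hj => ?_⟩
        have := h4 i j hi hj
        omega
    · intro g hg
      obtain ⟨hl, hag, _⟩ := pairTerm_ne_zero hg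
      refine ⟨?_, fun i j hi hj => ?_⟩
      · rintro rfl
        obtain ⟨i, hi, _⟩ := exists_of_lam_ne_zero hl
        simp at hi
      · have := ha g hag i j hi hj
        omega
  rw [Finset.sum_congr rfl h2, Finset.sum_comm]
  refine Finset.sum_congr rfl fun k _ => ?_
  rw [brk_smul_orbitSum ha, firstStrings_unfold (N := N)]
  · refine Finset.sum_congr rfl fun h _ => ?_
    -- Translating the pair moves the shift from `k` to `h`; `h` then runs over all strings with `k`
    -- fixed, as in `brk`.
    rw [← finsum_comp_equiv (Equiv.neg ℤ)]
    refine finsum_congr fun t => ?_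
    rw [← pairTerm_translate hta htb t, map_sub, translate_translate]
    simp
  · refine ((finite_support_brk ha b k).preimage (Equiv.subLeft k).injective.injOn).subset
      fun h hh => ?_
    have := left_ne_zero_of_smul hh
    simpa using this
  · intro h hh
    obtain ⟨hl, _, hbh⟩ := pairTerm_ne_zero hh
    refine ⟨?_, fun i j hi hj => ?_⟩
    · rintro rfl
      obtain ⟨i, _, hi⟩ := exists_of_lam_ne_zero hl
      simp at hi
    · have := hb h hbh i j hi hj
      omega

lemma conjTranspose_transport {S T : Type} (f : S → T) (X : Op d S) :
    (transport f X).conjTranspose = transport f X.conjTranspose := by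
  ext σ τ
  have h : (∀ t, t ∉ Set.range f → τ t = σ t) ↔ ∀ t, t ∉ Set.range f → σ t = τ t :=
    forall_congr' fun t => imp_congr_right fun _ => eq_comm
  simp only [Matrix.conjTranspose_apply, transport, apply_ite star, star_zero]
  by_cases hc : ∀ t, t ∉ Set.range f → σ t = τ t
  · rw [if_pos hc, if_pos (h.2 hc)]
  · rw [if_neg hc, if_neg fun h' => hc (h.1 h')]

lemma isHermitian_finiteSize {H : FormalOp d} (hH : H.IsSelfAdjoint) :
    (H.finiteSize N).IsHermitian := by
  have h : ∀ (A : Finset ℤ) (f : A → ZMod N),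
      (transport f (H.term A)).conjTranspose = transport f (H.term A) := fun A f => by
    rw [conjTranspose_transport, hH A]
  simp only [Matrix.IsHermitian, FormalOp.finiteSize, Matrix.conjTranspose_add,
    Matrix.conjTranspose_sum, h]

open ComplexOrder in
/-- For a Hermitian matrix the kernel of the squared adjoint action is the kernel of the adjoint
action. -/
lemma lie_eq_zero_of_lie_lie_eq_zero {ι : Type*} [Fintype ι] [DecidableEq ι]
    {A X : Matrix ι ι ℂ} (hA : A.IsHermitian) (h : ⁅A, ⁅A, X⁆⁆ = 0) : ⁅A, X⁆ = 0 := by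
  rw [← Matrix.trace_conjTranspose_mul_self_eq_zero_iff]
  set Y := ⁅A, X⁆ with hY
  have h1 : A * Y = Y * A := sub_eq_zero.1 h
  have h2 : Y.conjTranspose = X.conjTranspose * A - A * X.conjTranspose := by
    rw [hY, Ring.lie_def, Matrix.conjTranspose_sub, Matrix.conjTranspose_mul,
      Matrix.conjTranspose_mul, hA]
  -- The squared Hilbert–Schmidt norm of `Y` is the trace of X†AY - AX†Y, which vanishes by
  -- cyclicity because `A` commutes with `Y`.
  rw [h2, sub_mul, Matrix.trace_sub, mul_assoc, mul_assoc, Matrix.trace_mul_comm A, mul_assoc, h1,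
    sub_self]

end Ring

/-! ### The charges and their commutation -/

section Charges

variable {d : ℕ} [NeZero d]

/-- The left-most site of a string. -/
noncomputable def leftmost (k : Str d) : ℤ :=
  if h : k.support.Nonempty then k.support.min' h else 0

lemma leftmost_eq {k : Str d} {m : ℤ} (hm : k m ≠ 0) (h : ∀ i, k i ≠ 0 → m ≤ i) :
    leftmost k = m := by
  have hk : k.support.Nonempty := ⟨m, Finsupp.mem_support_iff.2 hm⟩
  rw [leftmost, dif_pos hk]
  exact le_antisymm (k.support.min'_le _ (Finsupp.mem_support_iff.2 hm))
    (h _ (Finsupp.mem_support_iff.1 (k.support.min'_mem hk)))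

lemma leftmost_spec {k : Str d} (hk : k ≠ 0) :
    k (leftmost k) ≠ 0 ∧ ∀ i, k i ≠ 0 → leftmost k ≤ i := by
  have hk : k.support.Nonempty := Finsupp.support_nonempty_iff.2 hk
  rw [leftmost, dif_pos hk]
  exact ⟨Finsupp.mem_support_iff.1 (k.support.min'_mem hk),
    fun i hi => k.support.min'_le _ (Finsupp.mem_support_iff.2 hi)⟩

lemma leftmost_translate (x : ℤ) {k : Str d} (hk : k ≠ 0) :
    leftmost (translate x k) = leftmost k + x := by
  obtain ⟨h1, h2⟩ := leftmost_spec hk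
  refine leftmost_eq (by rw [translate_apply, add_sub_cancel_right]; exact h1) fun i hi => ?_
  rw [translate_apply] at hi
  have := h2 _ hi
  omega

lemma coef_boost (H C : FormalOp d) :
    coef (FormalOp.boost H C) = (fun g => (leftmost g : ℂ) * coef H g) + coef C := by
  funext k
  rw [Pi.add_apply, coef, FormalOp.boost, map_add, map_smul, smul_eq_mul, leftmost]
  congr 2
  split_ifs <;> simp

lemma setRange_le_two {A : Finset ℤ} (h : ∃ i : ℤ, A = {i} ∨ A = {i, i + 1}) : setRange A ≤ 2 := by
  rw [setRange]
  split_ifs with hA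
  · have h1 := A.min'_mem hA
    have h2 := A.max'_mem hA
    obtain ⟨i, rfl | rfl⟩ := h <;>
    · simp only [Finset.mem_insert, Finset.mem_singleton] at h1 h2
      omega
  · omega

lemma setRange_boost_le {H C : FormalOp d} (hH : H.IsNearestNeighbor) (hC : C.IsOneLocal)
    (A : Finset ℤ) (hA : (FormalOp.boost H C).term A ≠ 0) : setRange A ≤ 2 := by
  by_cases h : H.term A = 0
  · have : C.term A ≠ 0 := by
      intro h'
      apply hA
      simp only [FormalOp.boost, h, h', smul_zero, add_zero]
    exact (hC A this).trans (by norm_num)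
  · exact setRange_le_two (hH A h)

lemma coef_zero_of_isNearestNeighbor {H : FormalOp d} (hH : H.IsNearestNeighbor) :
    coef H 0 = 0 := by
  refine coef_eq_zero_of_term ?_
  by_contra h
  obtain ⟨i, h | h⟩ := hH _ h
  · exact Finset.singleton_ne_empty i (h.symm.trans Finsupp.support_zero)
  · exact Finset.insert_ne_empty i _ (h.symm.trans Finsupp.support_zero)

lemma charge_two (H C : FormalOp d) : H.charge C 2 = H := rfl

lemma charge_succ (H C : FormalOp d) {n : ℕ} (hn : 2 ≤ n) :
    H.charge C (n + 1) = (FormalOp.boost H C).comm (H.charge C n) := by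
  rw [FormalOp.charge, FormalOp.charge, show n + 1 - 2 = (n - 2) + 1 by omega,
    Function.iterate_succ_apply']

lemma ringOp_zero (N : ℕ) [NeZero N] : ringOp N (0 : Str d → ℂ) = 0 := by
  simp [ringOp]

/-- For a Hermitian operator of finite range, the kernel of the squared adjoint action on
translation invariant operators of finite range is the kernel of the adjoint action. -/
lemma brk_eq_zero_of_brk_brk {H : FormalOp d} (hH : H.IsSelfAdjoint) {n m : ℕ} {q : Str d → ℂ}
    (hr : FinRange (n + 1) (coef H)) (ht : TransInv (coef H)) (hqr : FinRange (m + 1) q)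
    (hqt : TransInv q) (h : brk (coef H) (brk (coef H) q) = 0) : brk (coef H) q = 0 := by
  -- Any length works that allows both commutators with H to be computed on the ring and an operator
  -- of range n + m + 1 to be recovered from it.
  set N := 2 * (n + m + 1) + n with hN
  have : NeZero N := ⟨by omega⟩
  have hr' := hr.brk hqr
  have ht' := TransInv.brk hr ht hqt
  have h1 := lie_ringOp (N := N) hr hqr ht hqt (by omega)
  have h2 := lie_ringOp (N := N) hr hr' ht ht' (by omega)
  rw [h, ringOp_zero, ← h1, ← finiteSize_eq] at h2
  have h3 := lie_eq_zero_of_lie_lie_eq_zero (isHermitian_finiteSize hH) h2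
  rw [finiteSize_eq, h1] at h3
  exact eq_zero_of_ringOp_eq_zero hr' ht' (brk_apply_zero _ _) (by omega) h3

/-- The commutator of the Hamiltonian with the first charge has range at most three. -/
lemma finRange_brk_brk_boost {H C : FormalOp d} (hH : FinRange 2 (coef H))
    (hC : FinRange 1 (coef C)) :
    FinRange 3 (brk (coef H) (brk (coef (FormalOp.boost H C)) (coef H))) := by
  have hb : FinRange 2 (fun g => (leftmost g : ℂ) * coef H g) := fun g hg =>
    hH g (right_ne_zero_of_mul hg)
  rw [coef_boost, brk_add_left hb (hC.mono (by norm_num)), brk_add_right hH]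
  -- The contribution of `C` needs no cancellation: [C, H] still has range two, so [H, [C, H]] has
  -- range three.
  refine FinRange.add (brk_brk_boost hH ?_) (FinRange.brk (r := 1) (s := 1) hH ?_)
  · intro g hg i hi
    have h0 : g ≠ 0 := by
      rintro rfl
      simp at hi
    obtain ⟨h1, h2⟩ := leftmost_spec h0
    have := h2 i hi
    have := hH g hg _ i h1 hi
    omega
  · exact FinRange.brk (r := 0) (s := 1) hC hH

/-- If the Hamiltonian commutes with the first charge, all charges are translation invariant and
commute with the Hamiltonian. -/
lemma charges_of_brk_eq_zero {H C : FormalOp d} (hH_nn : H.IsNearestNeighbor)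
    (hH_sa : H.IsSelfAdjoint) (hH : TransInv (coef H)) (hC_one : C.IsOneLocal)
    (hC : TransInv (coef C)) (Q : ℕ → Str d → ℂ) (hQ2 : Q 2 = coef H)
    (hQ : ∀ n, 2 ≤ n → Q (n + 1) = brk (coef (FormalOp.boost H C)) (Q n)) :
    FinRange 2 (coef H) ∧ FinRange 2 (coef (FormalOp.boost H C)) ∧ TransInv (Q 3) ∧
    FinRange 3 (Q 3) ∧ (brk (coef H) (Q 3) = 0 → ∀ n, 2 ≤ n →
      TransInv (Q n) ∧ FinRange n (Q n) ∧ brk (coef H) (Q n) = 0) := by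
  have hr : FinRange 2 (coef H) := finRange_coef fun A hA => setRange_le_two (hH_nn A hA)
  have hbr : FinRange 2 (coef (FormalOp.boost H C)) :=
    finRange_coef (setRange_boost_le hH_nn hC_one)
  have h0 := coef_zero_of_isNearestNeighbor hH_nn
  set h := coef H with hh
  set b := coef (FormalOp.boost H C) with hb
  have hbt : ∀ (x : ℤ) (g : Str d), b (translate x g) = b g + x * h g := by
    intro x g
    rw [hb, coef_boost, Pi.add_apply, Pi.add_apply, hC, ← hh, hH]
    -- For the empty string `leftmost` is a default value that does not translate; the formula
    -- survives because H has no constant term.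
    by_cases hg : g = 0
    · subst hg
      rw [h0]; simp
    · rw [leftmost_translate x hg]
      push_cast; ring
  have step : ∀ q, TransInv q → brk h q = 0 → TransInv (brk b q) := by
    intro q hq hhq x k
    rw [brk_translate hbr hr (hbt x) hq k, hhq, Pi.zero_apply, mul_zero, add_zero]
  have hQ3 : Q 3 = brk b h := by rw [hQ 2 le_rfl, hQ2]
  have hQ3t : TransInv (Q 3) := by rw [hQ3]; exact step h hH (brk_self h)
  have hQ3r : FinRange 3 (Q 3) := by rw [hQ3]; exact FinRange.brk (r := 1) (s := 1) hbr hr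
  refine ⟨hr, hbr, hQ3t, hQ3r, fun hcons n hn => ?_⟩
  induction n, hn using Nat.le_induction with
  | base => rw [hQ2]; exact ⟨hH, hr, brk_self h⟩
  | succ n hn ih =>
    obtain ⟨ht, hrn, hc⟩ := ih
    obtain ⟨m, rfl⟩ : ∃ m, n = m + 1 := ⟨n - 1, by omega⟩
    have ht' : TransInv (Q (m + 1 + 1)) := by rw [hQ _ hn]; exact step _ ht hc
    have hr' : FinRange (m + 1 + 1) (Q (m + 1 + 1)) := by
      rw [hQ _ hn]
      exact (FinRange.brk (r := 1) hbr hrn).mono (by omega)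
    -- It suffices to kill the double commutator. Jacobi for (B, H, Q^(n)) gives [H, Q^(n+1)] =
    -- -[Q^(3), Q^(n)], and Jacobi for (H, Q^(3), Q^(n)) shows that this commutes with H.
    refine ⟨ht', hr', brk_eq_zero_of_brk_brk hH_sa (n := 1) hr hH hr' ht' ?_⟩
    set r := m + 3 with hrdef
    have e1 := brk_jacobi (hbr.mono (show 2 ≤ r by omega)) (hr.mono (show 2 ≤ r by omega))
      (hrn.mono (show m + 1 ≤ r by omega))
    have e2 := brk_jacobi (hr.mono (show 2 ≤ r by omega)) (hQ3r.mono (show 3 ≤ r by omega))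
      (hrn.mono (show m + 1 ≤ r by omega))
    rw [hc, brk_zero_right, ← hQ3, ← hQ _ hn] at e1
    rw [hc, brk_zero_right, hcons, brk_zero_left, add_zero] at e2
    have e3 : brk h (Q (m + 1 + 1)) = -brk (Q 3) (Q (m + 1)) := (neg_eq_of_add_eq_zero_right e1.symm).symm
    rw [← hh, e3, brk_neg_right, e2, neg_zero]

/-- If all charges commute with the Hamiltonian, they commute with each other. -/
lemma charges_commute {b h : Str d → ℂ} (hbr : FinRange 2 b) (Q : ℕ → Str d → ℂ) (hQ2 : Q 2 = h)
    (hQ : ∀ n, 2 ≤ n → Q (n + 1) = brk b (Q n)) (hr : ∀ n, 2 ≤ n → FinRange n (Q n))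
    (hc : ∀ n, 2 ≤ n → brk h (Q n) = 0) (n m : ℕ) (hn : 2 ≤ n) (hm : 2 ≤ m) :
    brk (Q n) (Q m) = 0 := by
  induction n, hn using Nat.le_induction generalizing m with
  | base => rw [hQ2]; exact hc m hm
  | succ n hn ih =>
    -- The induction hypothesis is used at both `m` and `m + 1`, hence the generalization over `m`.
    have e := brk_jacobi (hbr.mono (show 2 ≤ n + m by omega))
      ((hr n hn).mono (show n ≤ n + m by omega)) ((hr m hm).mono (show m ≤ n + m by omega))
    rw [ih m hm, brk_zero_right, ← hQ n hn, ← hQ m hm, ih (m + 1) (by omega), add_zero] at e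
    exact e.symm

end Charges

end SpinChain

open SpinChain in
theorem corollary1 (d : ℕ) (hd : 0 < d) (H C : SpinChain.FormalOp d)
    (hH_nn : H.IsNearestNeighbor) (hH_sa : H.IsSelfAdjoint) (hH_inv : H.IsTranslationInvariant)
    (hC_one : C.IsOneLocal) (hC_inv : C.IsTranslationInvariant)
    (N₀ : ℕ) [NeZero N₀] (hN₀ : 6 ≤ N₀)
    (hcons : ⁅H.finiteSize N₀, (H.charge C 3).finiteSize N₀⁆ = 0) :
    (∀ n : ℕ, 2 ≤ n → (H.charge C n).IsTranslationInvariant) ∧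
    (∀ (N : ℕ) [NeZero N], 4 ≤ N → ∀ n m : ℕ, 2 ≤ n → 2 ≤ m → 2 * n ≤ N → 2 * m ≤ N →
      ⁅(H.charge C n).finiteSize N, (H.charge C m).finiteSize N⁆ = 0) ∧
    (∀ (N : ℕ) [NeZero N], 4 ≤ N → ∀ n : ℕ, 2 ≤ n → 2 * n ≤ N →
      ⁅H.finiteSize N, (H.charge C n).finiteSize N⁆ = 0) := by
  have : NeZero d := ⟨hd.ne'⟩
  have hH := (isTranslationInvariant_iff H).1 hH_inv
  have hC := (isTranslationInvariant_iff C).1 hC_inv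
  have hQ : ∀ n, 2 ≤ n → coef (H.charge C (n + 1)) =
      brk (coef (FormalOp.boost H C)) (coef (H.charge C n)) := fun n hn => by
    rw [charge_succ H C hn, coef_comm (setRange_boost_le hH_nn hC_one)]
  obtain ⟨hr, hbr, hQ3t, hQ3r, main⟩ := charges_of_brk_eq_zero hH_nn hH_sa hH hC_one hC
    (fun n => coef (H.charge C n)) rfl hQ
  have hr3 : FinRange 3 (brk (coef H) (coef (H.charge C 3))) := by
    rw [hQ 2 le_rfl, charge_two]
    exact finRange_brk_brk_boost hr (finRange_coef hC_one)
  have hcons' : brk (coef H) (coef (H.charge C 3)) = 0 := by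
    rw [finiteSize_eq, finiteSize_eq,
      lie_ringOp (n := 1) (m := 2) hr hQ3r hH hQ3t (by omega)] at hcons
    -- Range three requires 2 · 3 ≤ N₀ + 1; the naive range four would require N₀ ≥ 7 and so miss N₀
    -- = 6.
    exact eq_zero_of_ringOp_eq_zero hr3 (TransInv.brk hr hH hQ3t) (brk_apply_zero _ _) (by omega)
      hcons
  have hall := main hcons'
  have hcomm : ∀ (N : ℕ) [NeZero N], 4 ≤ N → ∀ n m : ℕ, 2 ≤ n → 2 ≤ m → 2 * n ≤ N → 2 * m ≤ N →
      ⁅(H.charge C n).finiteSize N, (H.charge C m).finiteSize N⁆ = 0 := by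
    intro N _ _ n m hn hm hnN hmN
    -- Ranges `n` and `m` need n + m - 1 ≤ N, which follows from 2n ≤ N and 2m ≤ N.
    rw [finiteSize_eq, finiteSize_eq, lie_ringOp (n := n - 1) (m := m - 1)
      ((hall n hn).2.1.mono (by omega)) ((hall m hm).2.1.mono (by omega)) (hall n hn).1
      (hall m hm).1 (by omega), charges_commute hbr (fun n => coef (H.charge C n)) rfl hQ
        (fun n hn => (hall n hn).2.1) (fun n hn => (hall n hn).2.2) n m hn hm, ringOp_zero]
  exact ⟨fun n hn => (isTranslationInvariant_iff _).2 (hall n hn).1, hcomm,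
    fun N _ hN n hn hnN => hcomm N hN 2 n le_rfl hn (by omega) hnN⟩
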